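/- All graphs are finite, simple and undirected. Let $G=(V,E)$ be a graph, $s\in V$ and $C\subseteq V\setminus\{s\}$. For $S\subseteq V\setminus\{s\}$ let $R(s,S)$ be the set of vertices reachable from $s$ in $G\setminus S$. A set $S\subseteq V\setminus(\{s\}\cup C)$ is an *$s$–$C$ separator* if $R(s,S)\cap C=\emptyset$. An $s$–$C$ separator $S$ is *important* if no proper subset of $S$ is an $s$–$C$ separator and there is no $s$–$C$ separator $S_1$ with $|S_1|\le|S|$ and $R(s,S)\subsetneq R(s,S_1)$. *Firefighting.* A $k$-step strategy is a function $h:\{1,\dots,k\}\to V$. At time $0$ the vertex $s$ burns. At each time step $2i-1$ with $i\le k$ the vertex $h(i)$ is permanently protected; at each time step $2i$, $i\ge 1$, every unprotected neighbour of a burning vertex starts to burn. The strategy is *valid* if for every $i\le k$ the vertex $h(i)$ is not burning at time step $2i-1$ when it is to be protected (in the case that $h(1),\dots,h(i-1)$ have been placed). It *saves* $C$ if it is valid and $\{h(1),\dots,h(k)\}$ is an $s$–$C$ separator. The problem SACS asks, given $(G,s,C,k)$, whether some $k$-step strategy saves $C$. **Lemma.** (1) Let $G$ be a tree, $s\in V$,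 $C\subseteq V\setminus\{s\}$ and $k\ge 0$. (a) If some $k$-step strategy saves $C$, then there is an important $s$–$C$ separator $I$ with $|I|\le k$ such that placing the firefighters on the vertices of $I$, one after the other in any order of non-decreasing distance from $s$, is a valid ($|I|$-step) strategy that saves $C$. (b) If $I$ is an important $s$–$C$ separator and some strategy $h$ (with any number of steps) whose set of protected vertices is $I$ saves $C$, then placing the vertices of $I$, each once, in any order of non-decreasing distance from $s$ also saves $C$. (c) Conversely, if $|V|\ge 2$ and for some important $s$–$C$ separator $I$ with $|I|\le k$ the placement of $I$ in some order of non-decreasing distance from $s$ saves $C$, then $(G,s,C,k)$ is a yes-instance of SACS. (2) SACS on trees can be solved in time $O^*(4^k)$: there are a polynomial $p$ and a deterministic random access machine program (with constants, addition, truncated subtraction, indirect load and store, zero tests, unit cost per instruction and test) which, for every instance $(G,s,C,k)$ in which $G$ is a tree on the vertices $0,\dots,n-1$, given by its adjacency matrix, and $C$ is given by its characteristic vector, halts after at most $4^k\,p(n)$ steps and correctly reports whether $(G,s,C,k)$ is a yes-instance; if it is, the program also outputs an important $s$–$C$ separator of size at most $k$, listed in an order of non-decreasing distance from $s$, such that placing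 firefighters in this order saves $C$. -/

import Mathlib

/-! ## Separators -/

section Separators

variable {V : Type*}

/-- `R_G(X, S)`: the vertices reachable from `X` in `G ∖ S`, i.e. by a walk of `G` that starts in `X`
and has no vertex in `S`. -/
def reachSet (G : SimpleGraph V) (X S : Set V) : Set V :=
  {v | ∃ x ∈ X, ∃ p : G.Walk x v, ∀ w ∈ p.support, w ∉ S}

/-- `S ⊆ V ∖ (X ∪ Y)` is an `X`–`Y` separator if no vertex of `Y` is reachable from `X` in `G ∖ S`. -/
def IsSeparator (G : SimpleGraph V) (X Y S : Set V) : Prop :=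
  Disjoint S X ∧ Disjoint S Y ∧ Disjoint (reachSet G X S) Y

/-- An `X`–`Y` separator none of whose proper subsets is an `X`–`Y` separator. -/
def IsMinimalSeparator (G : SimpleGraph V) (X Y S : Set V) : Prop :=
  IsSeparator G X Y S ∧ ∀ T : Set V, T ⊂ S → ¬ IsSeparator G X Y T

/-- `S₁` covers `S` with respect to `X`. -/
def Covers (G : SimpleGraph V) (X S₁ S : Set V) : Prop :=
  reachSet G X S ⊂ reachSet G X S₁

/-- `S₁` dominates `S` with respect to `X`: it covers `S` and is not larger (for finite `V`). -/
def Dominates (G : SimpleGraph V) (X S₁ S : Set V) : Prop :=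
  S₁.ncard ≤ S.ncard ∧ Covers G X S₁ S

/-- Important `X`–`Y` separators: inclusionwise minimal, and not dominated by another separator. -/
def IsImportantSeparator (G : SimpleGraph V) (X Y S : Set V) : Prop :=
  IsMinimalSeparator G X Y S ∧
    ¬ ∃ S₁ : Set V, S₁ ≠ S ∧ IsSeparator G X Y S₁ ∧ Dominates G X S₁ S

end Separators

/-! ## The firefighting game -/

section Firefighting

variable {V : Type*}

/-- The burning vertices after `i` rounds, i.e. at time step `2 * i`, when the fire starts at `s` and
the firefighters are placed according to `h` (the strategy is indexed from `0`, so `h j` is placed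
at time step `2 * j + 1`; nothing is placed once `h` is exhausted). In round `i + 1` the firefighter
`h i` is placed first, then the fire spreads to every neighbour that is not protected. -/
def burning (G : SimpleGraph V) (s : V) {k : ℕ} (h : Fin k → V) : ℕ → Set V
  | 0 => {s}
  | i + 1 => burning G s h i ∪
      {v | (∃ u ∈ burning G s h i, G.Adj u v) ∧ ∀ j : Fin k, j.val ≤ i → h j ≠ v}

/-- A `k`-step strategy is valid if no vertex is burning at the moment at which it is to be
protected. -/
def IsValidStrategy (G : SimpleGraph V) (s : V) {k : ℕ} (h : Fin k → V) : Prop :=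
  ∀ i : Fin k, h i ∉ burning G s h i.val

/-- A strategy saves `C` if it is valid and its firefighters form an `s`–`C` separator. -/
def Saves (G : SimpleGraph V) (s : V) (C : Set V) {k : ℕ} (h : Fin k → V) : Prop :=
  IsValidStrategy G s h ∧ IsSeparator G {s} C (Set.range h)

/-- Saving A Critical Set: is there a valid `k`-step strategy that saves `C`? -/
def SACS (G : SimpleGraph V) (s : V) (C : Set V) (k : ℕ) : Prop :=
  ∃ h : Fin k → V, Saves G s C h

/-- `e` lists every element of `I` exactly once, in order of (weakly) increasing distance
from `s`. -/
def IsIncreasingListing (G : SimpleGraph V) (s : V) (I : Set V) {m : ℕ} (e : Fin m → V) : Prop :=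
  Function.Injective e ∧ Set.range e = I ∧ ∀ i j : Fin m, i ≤ j → G.dist s (e i) ≤ G.dist s (e j)

end Firefighting

/-! ## Random access machines

Structured programs for a random access machine with registers and a memory, both indexed by `ℕ`
and holding natural numbers. The arithmetic instructions are addition and truncated subtraction
only, so that with unit cost per instruction the running time is polynomially related to that of
a Turing machine. -/

namespace RAM

structure State where
  reg : ℕ → ℕ
  mem : ℕ → ℕ

def State.setReg (σ : State) (d x : ℕ) : State :=
  ⟨Function.update σ.reg d x, σ.mem⟩

def State.setMem (σ : State) (a x : ℕ) : State :=
  ⟨σ.reg, Function.update σ.mem a x⟩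

inductive Prog where
  /-- `reg d := c` -/
  | const (d c : ℕ)
  /-- `reg d := reg a + reg b` -/
  | add (d a b : ℕ)
  /-- `reg d := reg a - reg b`, truncated at `0` -/
  | sub (d a b : ℕ)
  /-- `reg d := mem (reg a)` -/
  | load (d a : ℕ)
  /-- `mem (reg a) := reg b` -/
  | store (a b : ℕ)
  /-- first `P`, then `Q` -/
  | seq (P Q : Prog)
  /-- `P` if `reg a ≠ 0`, otherwise `Q` -/
  | cond (a : ℕ) (P Q : Prog)
  /-- repeat `P` as long as `reg a ≠ 0` -/
  | loop (a : ℕ) (P : Prog)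

/-- `Runs P σ τ t`: started in the state `σ`, the program `P` halts in the state `τ` after exactly
`t` steps, where every instruction and every test of a register counts as one step. -/
inductive Runs : Prog → State → State → ℕ → Prop where
  | const (σ : State) (d c : ℕ) : Runs (.const d c) σ (σ.setReg d c) 1
  | add (σ : State) (d a b : ℕ) : Runs (.add d a b) σ (σ.setReg d (σ.reg a + σ.reg b)) 1
  | sub (σ : State) (d a b : ℕ) : Runs (.sub d a b) σ (σ.setReg d (σ.reg a - σ.reg b)) 1
  | load (σ : State) (d a : ℕ) : Runs (.load d a) σ (σ.setReg d (σ.mem (σ.reg a))) 1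
  | store (σ : State) (a b : ℕ) : Runs (.store a b) σ (σ.setMem (σ.reg a) (σ.reg b)) 1
  | seq {P Q : Prog} {σ τ ρ : State} {t u : ℕ} :
      Runs P σ τ t → Runs Q τ ρ u → Runs (.seq P Q) σ ρ (t + u)
  | cond_pos {a : ℕ} {P Q : Prog} {σ τ : State} {t : ℕ} :
      σ.reg a ≠ 0 → Runs P σ τ t → Runs (.cond a P Q) σ τ (t + 1)
  | cond_zero {a : ℕ} {P Q : Prog} {σ τ : State} {t : ℕ} :
      σ.reg a = 0 → Runs Q σ τ t → Runs (.cond a P Q) σ τ (t + 1)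
  | loop_pos {a : ℕ} {P : Prog} {σ τ ρ : State} {t u : ℕ} :
      σ.reg a ≠ 0 → Runs P σ τ t → Runs (.loop a P) τ ρ u → Runs (.loop a P) σ ρ (t + u + 1)
  | loop_zero {a : ℕ} {P : Prog} {σ : State} :
      σ.reg a = 0 → Runs (.loop a P) σ σ 1

open Classical in
/-- The initial state for the instance `(G, s, C, k)` with vertices `0, …, n - 1`: registers
`0, 1, 2` hold `n`, `s`, `k`; memory cells `0, …, n - 1` hold the characteristic vector of `C`, and
the next `n * n` cells the adjacency matrix of `G`, row by row; all else is `0`. -/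
noncomputable def input {n : ℕ} (G : SimpleGraph (Fin n)) (s : Fin n) (C : Set (Fin n)) (k : ℕ) :
    State where
  reg := fun r => if r = 0 then n else if r = 1 then s.val else if r = 2 then k else 0
  mem := fun a =>
    if (∃ v : Fin n, a = v.val ∧ v ∈ C) ∨
        (∃ u v : Fin n, a = n + u.val * n + v.val ∧ G.Adj u v) then 1 else 0

/-- The final state `τ` is a correct answer to the instance `(G, s, C, k)`: register `0` holds `1`
if the answer is yes and `0` if it is no, and in the first case the memory cells `0, …, m - 1`,
where `m` is the content of register `1`, list in order of increasing distance from `s` an important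
`s`–`C` separator of size `m ≤ k`, and this order is a strategy that saves `C`. -/
def IsAnswer {n : ℕ} (G : SimpleGraph (Fin n)) (s : Fin n) (C : Set (Fin n)) (k : ℕ)
    (τ : State) : Prop :=
  (¬ SACS G s C k → τ.reg 0 = 0) ∧
  (SACS G s C k → τ.reg 0 = 1 ∧ τ.reg 1 ≤ k ∧
    ∃ (I : Set (Fin n)) (e : Fin (τ.reg 1) → Fin n),
      IsImportantSeparator G {s} C I ∧ IsIncreasingListing G s I e ∧ Saves G s C e ∧
      ∀ i : Fin (τ.reg 1), τ.mem i.val = (e i).val)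

end RAM

/-! Root the tree at `s`. A set `S` cuts off a vertex exactly if it contains that vertex or one of
its ancestors, and the fire reaches a vertex at distance `d` after `d` rounds unless it or an
ancestor is protected in time. So only the topmost protected vertices matter, and each of them must
be protected after fewer rounds than its distance from `s`.

Call a vertex above part of `C` tight if no lower vertex outside `C` cuts off that whole part. A
protected vertex can be pushed down to a tight one: it still cuts off the same part of `C`, and its
deadline only moves back. Applied to the topmost protected vertices above `C`, this turns a saving
strategy into an antichain of tight vertices that is no larger and still meets its deadlines
(`IsParentMap.exists_isTightCut`). Such an antichain is an important separator
(`IsTightCut.isImportantSeparator`): a dominating separator has exactly one vertex below each of its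
members, and tightness makes the two coincide. If a set admits distinct times before its deadlines
at all, the pigeonhole principle shows that every order of non-decreasing distance works
(`IsTimely.lt_dist`).

For the algorithm, go through the tree layer by layer and decide for each tight vertex not yet cut
off whether to select it. A tight vertex above the desired cut `I` has at least two members of `I`
below it, so at most `|I|` tight vertices are rejected on the way to `I`
(`IsParentMap.ncard_open_le`). Hence at most `2 * k` binary decisions are needed, and they can be
read off the digits of `y / 4 ^ k` for some `y < 4 ^ k` (`IsTightCut.exists_guide`). Conversely,
every run that ends without failure yields a tight cut in a valid order (`Selection.isSound_foldl`).
The machine tabulates distances, parents and the data that decide tightness, and then tries all `4 ^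
k` guides in polynomial time each. -/

/-! ## Rooted trees -/

section RootedTree

variable {V : Type*} {G : SimpleGraph V} {s : V} {par : V → V} {C : Set V}

/-- `par` sends every vertex of the tree `G` rooted at `s` to its parent, and `s` to itself. -/
structure IsParentMap (G : SimpleGraph V) (s : V) (par : V → V) : Prop where
  root : par s = s
  adj : ∀ v, v ≠ s → G.Adj (par v) v
  dist : ∀ v, v ≠ s → G.dist s (par v) + 1 = G.dist s v
  eq_of_adj : ∀ u v, G.Adj u v → (u = par v ∧ v ≠ s) ∨ (v = par u ∧ u ≠ s)

/-- Shortest paths to `u` and `w` extend to shortest paths to `v`, and paths in a tree are unique,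
so they have the same penultimate vertex. -/
theorem SimpleGraph.IsTree.eq_of_adj_of_dist_lt (hG : G.IsTree) {u w v : V} (hu : G.Adj u v)
    (hw : G.Adj w v) (hdu : G.dist s v = G.dist s u + 1) (hdw : G.dist s v = G.dist s w + 1) :
    u = w := by
  obtain ⟨p, hp, hpl⟩ := hG.1.exists_path_of_dist s u
  obtain ⟨q, hq, hql⟩ := hG.1.exists_path_of_dist s w
  have h1 : (p.concat hu).IsPath := SimpleGraph.Walk.isPath_of_length_eq_dist _ (by simp [hpl, hdu])
  have h2 : (q.concat hw).IsPath := SimpleGraph.Walk.isPath_of_length_eq_dist _ (by simp [hql, hdw])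
  have h3 := hG.existsUnique_path s v |>.unique h1 h2
  have h4 := congrArg SimpleGraph.Walk.penultimate h3
  simpa using h4

theorem SimpleGraph.IsTree.exists_isParentMap (hG : G.IsTree) (s : V) :
    ∃ par, IsParentMap G s par := by
  classical
  have hex : ∀ v, ∃ u, (v = s → u = s) ∧ (v ≠ s → G.Adj u v ∧ G.dist s u + 1 = G.dist s v) := by
    intro v
    by_cases hv : v = s
    · exact ⟨s, by simp [hv]⟩
    obtain ⟨p, hp, hpl⟩ := hG.1.exists_path_of_dist s v
    have hnil : ¬ p.Nil := fun h => hv h.eq.symm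
    refine ⟨p.penultimate, fun h => absurd h hv, fun _ => ⟨p.adj_penultimate hnil, ?_⟩⟩
    have h1 : G.dist s p.penultimate ≤ p.length - 1 :=
      (SimpleGraph.dist_le p.dropLast).trans (by simp)
    have h2 := hG.dist_eq_dist_add_one_of_adj s (p.adj_penultimate hnil)
    have h3 : 0 < p.length := by
      rw [Nat.pos_iff_ne_zero]; exact fun h => hnil (SimpleGraph.Walk.length_eq_zero_iff.1 h)
    omega
  choose par h1 h2 using hex
  refine ⟨par, h1 s rfl, fun v hv => (h2 v hv).1, fun v hv => (h2 v hv).2, fun u v huv => ?_⟩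
  rcases hG.dist_eq_dist_add_one_of_adj s huv with h | h
  · have hu : u ≠ s := by rintro rfl; simp at h
    exact Or.inr ⟨hG.eq_of_adj_of_dist_lt huv.symm (h2 u hu).1 h (h2 u hu).2.symm, hu⟩
  · have hv : v ≠ s := by rintro rfl; simp at h
    exact Or.inl ⟨hG.eq_of_adj_of_dist_lt huv (h2 v hv).1 h (h2 v hv).2.symm, hv⟩

/-- `u` is an ancestor of `v`, or `v` itself. -/
def IsAnc (par : V → V) (u v : V) : Prop := ∃ j, par^[j] v = u

theorem IsAnc.refl (par : V → V) (v : V) : IsAnc par v v := ⟨0, rfl⟩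

theorem IsAnc.trans {u v w : V} (h : IsAnc par u v) (h' : IsAnc par v w) : IsAnc par u w := by
  obtain ⟨i, rfl⟩ := h
  obtain ⟨j, rfl⟩ := h'
  exact ⟨i + j, Function.iterate_add_apply _ _ _ _⟩

theorem isAnc_iff_eq_or_par {u v : V} : IsAnc par u v ↔ u = v ∨ IsAnc par u (par v) := by
  constructor
  · rintro ⟨_ | j, rfl⟩
    · exact Or.inl rfl
    · exact Or.inr ⟨j, rfl⟩
  · rintro (rfl | ⟨j, rfl⟩)
    · exact IsAnc.refl _ _
    · exact ⟨j + 1, rfl⟩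

namespace IsParentMap

/-- Truncated subtraction matches `par s = s`: a walk that has arrived at the root stays there. -/
theorem dist_iterate (hp : IsParentMap G s par) (v : V) (j : ℕ) :
    G.dist s (par^[j] v) = G.dist s v - j := by
  induction j generalizing v with
  | zero => rfl
  | succ j ih =>
    rw [Function.iterate_succ_apply, ih]
    by_cases hv : v = s
    · subst hv; simp [hp.root]
    · have := hp.dist v hv; omega

theorem eq_root_of_dist (hp : IsParentMap G s par) {v : V} (h : G.dist s v = 0) : v = s := by
  by_contra hv
  have := hp.dist v hv; omega

theorem iterate_dist (hp : IsParentMap G s par) (v : V) : par^[G.dist s v] v = s :=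
  hp.eq_root_of_dist (by simp [hp.dist_iterate])

theorem iterate_root (hp : IsParentMap G s par) (j : ℕ) : par^[j] s = s :=
  Function.iterate_fixed hp.root j

theorem dist_le (hp : IsParentMap G s par) {u v : V} (h : IsAnc par u v) :
    G.dist s u ≤ G.dist s v := by
  obtain ⟨j, rfl⟩ := h
  simp [hp.dist_iterate]

theorem iterate_sub (hp : IsParentMap G s par) {u v : V} (h : IsAnc par u v) :
    par^[G.dist s v - G.dist s u] v = u := by
  obtain ⟨j, rfl⟩ := h
  rw [hp.dist_iterate]
  rcases le_total j (G.dist s v) with h | h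
  · congr 1; rw [Nat.sub_sub_self h]
  · rw [Nat.sub_eq_zero_of_le h, Nat.sub_zero, hp.iterate_dist]
    obtain ⟨i, rfl⟩ := Nat.exists_eq_add_of_le' h
    rw [Function.iterate_add_apply, hp.iterate_dist, hp.iterate_root]

theorem eq_of_isAnc (hp : IsParentMap G s par) {u v : V} (h : IsAnc par u v)
    (hd : G.dist s v ≤ G.dist s u) : u = v := by
  have := hp.iterate_sub h
  rw [Nat.sub_eq_zero_of_le hd] at this
  exact this.symm

theorem isAnc_of_le (hp : IsParentMap G s par) {u v w : V} (hu : IsAnc par u w)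
    (hv : IsAnc par v w) (hd : G.dist s u ≤ G.dist s v) : IsAnc par u v := by
  refine ⟨G.dist s v - G.dist s u, ?_⟩
  rw [← hp.iterate_sub hv, ← Function.iterate_add_apply, hp.iterate_sub hv]
  have := hp.dist_le hv
  rw [show G.dist s v - G.dist s u + (G.dist s w - G.dist s v) = G.dist s w - G.dist s u by omega]
  exact hp.iterate_sub hu

theorem total (hp : IsParentMap G s par) {u v w : V} (hu : IsAnc par u w) (hv : IsAnc par v w) :
    IsAnc par u v ∨ IsAnc par v u :=
  (le_total (G.dist s u) (G.dist s v)).imp (hp.isAnc_of_le hu hv) (hp.isAnc_of_le hv hu)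

/-- Every edge joins a parent and a child, so extending a walk by an edge adds at most its new
endpoint to the set of ancestors; conversely the chain of ancestors is itself a walk. -/
theorem mem_reachSet (hp : IsParentMap G s par) {S : Set V} {v : V} :
    v ∈ reachSet G {s} S ↔ ∀ u, IsAnc par u v → u ∉ S := by
  constructor
  · rintro ⟨x, rfl, p, hpS⟩
    induction p using SimpleGraph.Walk.concatRec with
    | Hnil =>
      rintro u ⟨j, rfl⟩
      rw [hp.iterate_root]
      exact hpS _ (by simp)
    | Hconcat p h ih =>
      rename_i a b c
      have ih := ih hp (fun w hw => hpS w (by simp [SimpleGraph.Walk.support_concat, hw]))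
      have hc : c ∉ S := hpS c (by simp)
      rcases hp.eq_of_adj _ _ h with ⟨rfl, -⟩ | ⟨rfl, -⟩
      · intro u hu
        rcases isAnc_iff_eq_or_par.1 hu with rfl | hu
        · exact hc
        · exact ih u hu
      · exact fun u hu => ih u (isAnc_iff_eq_or_par.2 (Or.inr hu))
  · intro h
    refine ⟨s, rfl, ?_⟩
    induction hd : G.dist s v generalizing v with
    | zero =>
      obtain rfl := hp.eq_root_of_dist hd
      exact ⟨.nil, by simpa using h _ (IsAnc.refl _ _)⟩
    | succ d ih =>
      have hv : v ≠ s := by rintro rfl; simp at hd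
      obtain ⟨p, hpS⟩ := ih (fun u hu => h u (isAnc_iff_eq_or_par.2 (Or.inr hu)))
        (by have := hp.dist v hv; omega)
      refine ⟨p.concat (hp.adj v hv), fun w hw => ?_⟩
      rw [SimpleGraph.Walk.support_concat] at hw
      simp only [List.mem_append, List.mem_singleton] at hw
      rcases hw with hw | rfl
      · exact hpS w hw
      · exact h _ (IsAnc.refl _ _)

theorem isSeparator_iff (hp : IsParentMap G s par) {S : Set V} :
    IsSeparator G {s} C S ↔ s ∉ S ∧ Disjoint S C ∧ ∀ c ∈ C, ∃ u ∈ S, IsAnc par u c := by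
  refine and_congr (by simp) (and_congr Iff.rfl ?_)
  rw [Set.disjoint_right]
  refine forall₂_congr fun c _ => ?_
  rw [hp.mem_reachSet]
  push Not
  exact exists_congr fun u => and_comm

/-! ### Spread of the fire in a rooted tree -/

theorem dist_le_of_mem_burning (hp : IsParentMap G s par) {k : ℕ} {h : Fin k → V} {i : ℕ} {v : V}
    (hv : v ∈ burning G s h i) : G.dist s v ≤ i := by
  induction i generalizing v with
  | zero => obtain rfl : v = s := hv; simp
  | succ i ih =>
    rcases hv with hv | ⟨⟨u, hu, huv⟩, -⟩
    · exact (ih hv).trans (Nat.le_succ i)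
    · have h1 := ih hu
      rcases hp.eq_of_adj _ _ huv with ⟨rfl, hv⟩ | ⟨rfl, hu⟩
      · have := hp.dist v hv; omega
      · have := hp.dist u hu; omega

theorem mem_burning (hp : IsParentMap G s par) {k : ℕ} {h : Fin k → V} {i : ℕ} {v : V}
    (hd : G.dist s v ≤ i) (hv : ∀ u, IsAnc par u v → ∀ j : Fin k, j.val < i → h j ≠ u) :
    v ∈ burning G s h i := by
  induction i generalizing v with
  | zero => exact hp.eq_root_of_dist (Nat.le_zero.1 hd)
  | succ i ih =>
    rcases hd.lt_or_eq with hd | hd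
    · exact Or.inl (ih (Nat.lt_succ_iff.1 hd) fun u hu j hj =>
        hv u hu j (hj.trans (Nat.lt_succ_self i)))
    · have hvs : v ≠ s := by rintro rfl; simp at hd
      refine Or.inr ⟨⟨par v, ih (by have := hp.dist v hvs; omega) fun u hu j hj =>
        hv u (isAnc_iff_eq_or_par.2 (Or.inr hu)) j (hj.trans (Nat.lt_succ_self i)), hp.adj v hvs⟩,
        fun j hj => hv v (IsAnc.refl _ _) j (Nat.lt_succ_of_le hj)⟩

/-- At the first placement on `v` no ancestor of `v` has been protected, by the choice of `v` as
topmost; were it as late as the distance of `v`, the fire would have come straight down to `v`. -/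
theorem exists_time (hp : IsParentMap G s par) {k : ℕ} {h : Fin k → V} (hval : IsValidStrategy G s h)
    {v : V} (hv : v ∈ Set.range h) (htop : ∀ u ∈ Set.range h, IsAnc par u v → u = v) :
    ∃ j : Fin k, h j = v ∧ j.val < G.dist s v := by
  classical
  obtain ⟨j, hj, hmin⟩ := Set.exists_min_image {j : Fin k | h j = v} id (Set.toFinite _) hv
  refine ⟨j, hj, ?_⟩
  by_contra hlt
  refine hval j ?_
  rw [show h j = v from hj]
  refine hp.mem_burning (not_lt.1 hlt) fun u hu i hi hiu => ?_
  have h1 : u = v := htop u ⟨i, hiu⟩ hu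
  exact absurd (hmin i (hiu.trans h1)) (not_le.2 hi)

end IsParentMap

/-! ## Tight vertices -/

/-- A vertex above some of `C` whose part of `C` is not cut off by a lower vertex. -/
def IsTight (par : V → V) (s : V) (C : Set V) (v : V) : Prop :=
  v ≠ s ∧ v ∉ C ∧ (∃ c ∈ C, IsAnc par v c) ∧
    ∀ w, w ≠ v → w ∉ C → IsAnc par v w → ∃ c ∈ C, IsAnc par v c ∧ ¬ IsAnc par w c

/-- An antichain of tight vertices that cuts off `C`. -/
structure IsTightCut (par : V → V) (s : V) (C I : Set V) : Prop where
  tight : ∀ v ∈ I, IsTight par s C v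
  antichain : ∀ u ∈ I, ∀ v ∈ I, IsAnc par u v → u = v
  cut : ∀ c ∈ C, ∃ u ∈ I, IsAnc par u c

/-- The vertices of `I` can be given distinct times at which they are not yet reached by fire. -/
def IsTimely (G : SimpleGraph V) (s : V) (I : Set V) : Prop :=
  ∃ τ : V → ℕ, Set.InjOn τ I ∧ ∀ v ∈ I, τ v < G.dist s v

theorem IsTightCut.isSeparator (hp : IsParentMap G s par) {I : Set V} (hI : IsTightCut par s C I) :
    IsSeparator G {s} C I :=
  hp.isSeparator_iff.2 ⟨fun h => (hI.tight s h).1 rfl,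
    Set.disjoint_left.2 fun v hv => (hI.tight v hv).2.1, hI.cut⟩

/-- Minimality: below each member of `I` lies a vertex of `C` that, by the antichain property, no
other member cuts off. For domination, covering forces the vertices of `S` above `C` to lie below
`I`; choosing one below each member gives an injection, which the size bound makes onto `S`. So a
single vertex of `S` cuts off all of `C` below a given member, and by tightness it is that member.
-/
theorem IsTightCut.isImportantSeparator [Finite V] (hp : IsParentMap G s par) {I : Set V}
    (hI : IsTightCut par s C I) : IsImportantSeparator G {s} C I := by
  classical
  refine ⟨⟨hI.isSeparator hp, fun T hT hsep => ?_⟩, ?_⟩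
  · obtain ⟨v, hv, hvT⟩ := Set.exists_of_ssubset hT
    obtain ⟨c, hc, hvc⟩ := (hI.tight v hv).2.2.1
    obtain ⟨u, hu, huc⟩ := (hp.isSeparator_iff.1 hsep).2.2 c hc
    rcases hp.total huc hvc with h | h
    · exact hvT (hI.antichain u (hT.1 hu) v hv h ▸ hu)
    · exact hvT (hI.antichain v hv u (hT.1 hu) h ▸ hu)
  · rintro ⟨S, hne, hS, hcard, hcov⟩
    obtain ⟨-, hSC, hcut⟩ := hp.isSeparator_iff.1 hS
    have hbelow : ∀ v ∈ I, ∀ c ∈ C, IsAnc par v c → ∀ u ∈ S, IsAnc par u c → IsAnc par v u := by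
      intro v hv c hc hvc u hu huc
      rcases hp.total hvc huc with h | h
      · exact h
      by_contra hvu
      -- If `u` were strictly above `v`, it would be reachable past `I`, hence past `S` by covering,
      -- although it lies in `S`.
      have hur : u ∈ reachSet G {s} I := hp.mem_reachSet.2 fun w hw hwI =>
        hvu (hI.antichain w hwI v hv (hw.trans h) ▸ hw)
      exact hp.mem_reachSet.1 (hcov.1 hur) u (IsAnc.refl _ _) hu
    have hex : ∀ v, ∃ u, v ∈ I → u ∈ S ∧ IsAnc par v u := by
      intro v
      by_cases hv : v ∈ I
      · obtain ⟨c, hc, hvc⟩ := (hI.tight v hv).2.2.1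
        obtain ⟨u, hu, huc⟩ := hcut c hc
        exact ⟨u, fun _ => ⟨hu, hbelow v hv c hc hvc u hu huc⟩⟩
      · exact ⟨v, fun h => absurd h hv⟩
    choose f hf using hex
    have huniq : ∀ v ∈ I, ∀ w ∈ I, IsAnc par v (f w) → v = w := by
      intro v hv w hw h
      rcases hp.total h (hf w hw).2 with h | h
      · exact hI.antichain v hv w hw h
      · exact (hI.antichain w hw v hv h).symm
    have hinj : Set.InjOn f I := fun v hv w hw h => huniq v hv w hw (h ▸ (hf v hv).2)
    have himg : f '' I = S := by
      refine Set.eq_of_subset_of_ncard_le (Set.image_subset_iff.2 fun v hv => (hf v hv).1) ?_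
      rw [hinj.ncard_image]; exact hcard
    have hfix : ∀ v ∈ I, f v = v := by
      intro v hv
      by_contra hfv
      obtain ⟨c, hc, hvc, hnc⟩ := (hI.tight v hv).2.2.2 (f v) hfv
        (Set.disjoint_left.1 hSC (hf v hv).1) (hf v hv).2
      obtain ⟨u, hu, huc⟩ := hcut c hc
      have hvu := hbelow v hv c hc hvc u hu huc
      obtain ⟨w, hw, rfl⟩ := himg.symm ▸ hu
      obtain rfl := huniq v hv w hw hvu
      exact hnc huc
    refine hne ?_
    rw [← himg, Set.image_congr hfix, Set.image_id']

/-- Take a deepest vertex outside `C` that is above everything in `C` below `v`. -/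
theorem IsParentMap.exists_isTight [Finite V] (hp : IsParentMap G s par) {v : V} (hs : v ≠ s)
    (hvC : v ∉ C) (hv : ∃ c ∈ C, IsAnc par v c) :
    ∃ w, IsAnc par v w ∧ IsTight par s C w ∧ ∀ c ∈ C, IsAnc par v c → IsAnc par w c := by
  obtain ⟨w, ⟨hvw, hwC, hw⟩, hmax⟩ := Set.exists_max_image
    {w | IsAnc par v w ∧ w ∉ C ∧ ∀ c ∈ C, IsAnc par v c → IsAnc par w c} (G.dist s) (Set.toFinite _)
    ⟨v, IsAnc.refl _ _, hvC, fun _ _ h => h⟩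
  refine ⟨w, hvw, ⟨?_, hwC, ?_, fun x hxw hxC hwx => ?_⟩, hw⟩
  · rintro rfl
    exact hs (hp.eq_of_isAnc hvw (by simp))
  · obtain ⟨c, hc, hvc⟩ := hv
    exact ⟨c, hc, hw c hc hvc⟩
  · by_contra! hcon
    exact hxw (hp.eq_of_isAnc hwx
      (hmax x ⟨hvw.trans hwx, hxC, fun c hc hvc => hcon c hc (hw c hc hvc)⟩)).symm

/-- `S` consists of the topmost protected vertices above `C`, `τ` gives their times and `g` pushes
them down to tight vertices. Different members of `S` lie in different branches, so `g` is injective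
and the times carry over to its image. -/
theorem IsParentMap.exists_isTightCut [Finite V] (hp : IsParentMap G s par) {k : ℕ} {h : Fin k → V}
    (hsave : Saves G s C h) : ∃ I, IsTightCut par s C I ∧ I.ncard ≤ k ∧ IsTimely G s I := by
  classical
  obtain ⟨hval, hsep⟩ := hsave
  obtain ⟨hs, hdisj, hcut⟩ := hp.isSeparator_iff.1 hsep
  set S : Set V := {v | v ∈ Set.range h ∧ (∀ u ∈ Set.range h, IsAnc par u v → u = v) ∧
    ∃ c ∈ C, IsAnc par v c} with hS
  have hτ : ∀ v, ∃ j : ℕ, v ∈ S → ∃ hj : j < k, h ⟨j, hj⟩ = v ∧ j < G.dist s v := by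
    intro v
    by_cases hv : v ∈ S
    · obtain ⟨j, hj, hj'⟩ := hp.exists_time hval hv.1 hv.2.1
      exact ⟨j, fun _ => ⟨j.2, hj, hj'⟩⟩
    · exact ⟨0, fun h => absurd h hv⟩
  choose τ hτ using hτ
  have hg : ∀ v, ∃ w, v ∈ S → IsAnc par v w ∧ IsTight par s C w ∧
      ∀ c ∈ C, IsAnc par v c → IsAnc par w c := by
    intro v
    by_cases hv : v ∈ S
    · obtain ⟨w, hw⟩ := hp.exists_isTight (C := C) (v := v) (by rintro rfl; exact hs hv.1)
        (Set.disjoint_left.1 hdisj hv.1) hv.2.2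
      exact ⟨w, fun _ => hw⟩
    · exact ⟨v, fun h => absurd h hv⟩
  choose g hg using hg
  have huniq : ∀ u ∈ S, ∀ v ∈ S, IsAnc par u (g v) → u = v := by
    intro u hu v hv huv
    rcases hp.total huv (hg v hv).1 with h | h
    · exact hv.2.1 u hu.1 h
    · exact (hu.2.1 v hv.1 h).symm
  have hτinj : Set.InjOn τ S := by
    intro u hu v hv huv
    obtain ⟨h1, h2, -⟩ := hτ u hu
    obtain ⟨h3, h4, -⟩ := hτ v hv
    rw [← h2, ← h4]; simp only [huv]
  have hginj : Set.InjOn g S := fun u hu v hv huv => huniq u hu v hv (huv ▸ (hg u hu).1)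
  refine ⟨g '' S, ⟨?_, ?_, ?_⟩, ?_, ?_⟩
  · rintro _ ⟨v, hv, rfl⟩; exact (hg v hv).2.1
  · rintro _ ⟨u, hu, rfl⟩ _ ⟨v, hv, rfl⟩ huv
    rw [huniq u hu v hv ((hg u hu).1.trans huv)]
  · intro c hc
    obtain ⟨u, ⟨hu, huc⟩, hmin⟩ := Set.exists_min_image {u | u ∈ Set.range h ∧ IsAnc par u c}
      (G.dist s) (Set.toFinite _) (hcut c hc)
    have huS : u ∈ S := ⟨hu, fun w hw hwu => hp.eq_of_isAnc hwu (hmin w ⟨hw, hwu.trans huc⟩),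
      c, hc, huc⟩
    exact ⟨g u, ⟨u, huS, rfl⟩, (hg u huS).2.2 c hc huc⟩
  -- The bound on the size holds because the times are distinct numbers below `k`.
  · rw [hginj.ncard_image, ← hτinj.ncard_image]
    calc (τ '' S).ncard ≤ (Set.Iio k).ncard := Set.ncard_le_ncard (by
          rintro _ ⟨v, hv, rfl⟩; exact (hτ v hv).1) (Set.toFinite _)
      _ = k := by simp [Set.ncard_eq_toFinset_card']
  · rcases S.eq_empty_or_nonempty with hemp | ⟨v₀, -⟩
    · exact ⟨fun _ => 0, by simp [hemp], by simp [hemp]⟩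
    have : Nonempty V := ⟨v₀⟩
    refine ⟨τ ∘ Function.invFunOn g S, ?_, ?_⟩
    · rintro _ ⟨u, hu, rfl⟩ _ ⟨v, hv, rfl⟩ huv
      simp only [Function.comp, hginj.leftInvOn_invFunOn hu, hginj.leftInvOn_invFunOn hv] at huv
      rw [hτinj hu hv huv]
    · rintro _ ⟨v, hv, rfl⟩
      simp only [Function.comp, hginj.leftInvOn_invFunOn hv]
      exact (hτ v hv).2.2.trans_le (hp.dist_le (hg v hv).1)

/-! ### Placement in order of distance -/

theorem IsParentMap.saves_of_lt_dist (hp : IsParentMap G s par) {m : ℕ} {e : Fin m → V}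
    (hsep : IsSeparator G {s} C (Set.range e)) (he : ∀ j, j.val < G.dist s (e j)) :
    Saves G s C e :=
  ⟨fun j hj => absurd (hp.dist_le_of_mem_burning hj) (not_le.2 (he j)), hsep⟩

/-- The first `j + 1` listed vertices have distinct times, all below the distance of the last of
them, so this distance is at least `j + 1`. -/
theorem IsTimely.lt_dist {I : Set V} (hI : IsTimely G s I) {m : ℕ} {e : Fin m → V}
    (he : IsIncreasingListing G s I e) (j : Fin m) : j.val < G.dist s (e j) := by
  obtain ⟨τ, hinj, hτ⟩ := hI
  obtain ⟨he1, rfl, he3⟩ := he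
  have := Finset.card_le_card_of_injOn (s := Finset.Iic j) (t := Finset.range (G.dist s (e j)))
    (fun i => τ (e i))
    (fun i hi => by
      simp only [Finset.coe_Iic, Set.mem_Iic] at hi
      simpa using (hτ (e i) ⟨i, rfl⟩).trans_le (he3 i j hi))
    (fun i _ i' _ h => he1 (hinj ⟨i, rfl⟩ ⟨i', rfl⟩ h))
  simpa using this

theorem exists_isIncreasingListing [Finite V] (G : SimpleGraph V) (s : V) (I : Set V) :
    ∃ e : Fin I.ncard → V, IsIncreasingListing G s I e := by
  classical
  have e₀ : Fin I.ncard ≃ I := (Finite.equivFinOfCardEq (Nat.card_coe_set_eq I)).symm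
  let f : Fin I.ncard → ℕ := fun i => G.dist s (e₀ i)
  refine ⟨fun i => e₀ (Tuple.sort f i), ?_, ?_, fun i j hij => Tuple.monotone_sort f hij⟩
  · exact Subtype.val_injective.comp (e₀.injective.comp (Tuple.sort f).injective)
  · ext v
    constructor
    · rintro ⟨i, rfl⟩; exact (e₀ _).2
    · intro hv
      exact ⟨(Tuple.sort f).symm (e₀.symm ⟨v, hv⟩), by simp⟩

/-- A minimal separator is an antichain, so each of its vertices is topmost and `exists_time`
supplies its time. -/
theorem IsParentMap.isTimely_of_saves (hp : IsParentMap G s par) {I : Set V}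
    (hI : IsMinimalSeparator G {s} C I) {m : ℕ} {h : Fin m → V} (hr : Set.range h = I)
    (hsave : Saves G s C h) : IsTimely G s I := by
  classical
  obtain ⟨h1, h2, h3⟩ := hp.isSeparator_iff.1 hI.1
  have htop : ∀ v ∈ I, ∀ u ∈ I, IsAnc par u v → u = v := by
    intro v hv u hu huv
    by_contra hne
    refine hI.2 (I \ {v}) ⟨Set.sdiff_subset, fun h => (h hv).2 rfl⟩
      (hp.isSeparator_iff.2 ⟨fun h => h1 h.1, h2.mono_left Set.sdiff_subset, fun c hc => ?_⟩)
    obtain ⟨w, hw, hwc⟩ := h3 c hc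
    by_cases hwv : w = v
    · exact ⟨u, ⟨hu, hne⟩, huv.trans (hwv ▸ hwc)⟩
    · exact ⟨w, ⟨hw, hwv⟩, hwc⟩
  have hτ : ∀ v, ∃ j : ℕ, v ∈ I → ∃ hj : j < m, h ⟨j, hj⟩ = v ∧ j < G.dist s v := by
    intro v
    by_cases hv : v ∈ I
    · obtain ⟨j, hj, hj'⟩ := hp.exists_time hsave.1 (hr ▸ hv) (hr ▸ htop v hv)
      exact ⟨j, fun _ => ⟨j.2, hj, hj'⟩⟩
    · exact ⟨0, fun h => absurd h hv⟩
  choose τ hτ using hτ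
  refine ⟨τ, fun u hu v hv huv => ?_, fun v hv => (hτ v hv).2.2⟩
  obtain ⟨h1, h2, -⟩ := hτ u hu
  obtain ⟨h3, h4, -⟩ := hτ v hv
  rw [← h2, ← h4]; simp only [huv]

theorem mem_burning_of_protected {k : ℕ} {h : Fin k → V} {i : ℕ} {v : V} (j : Fin k)
    (hj : h j = v) (hvj : v ∉ burning G s h j.val) (hij : j.val ≤ i) :
    v ∉ burning G s h i := by
  induction i with
  | zero => rwa [Nat.le_zero.1 hij] at hvj
  | succ i ih =>
    rcases hij.lt_or_eq with hlt | heq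
    · rintro (h1 | ⟨-, h2⟩)
      · exact ih (Nat.lt_succ_iff.1 hlt) h1
      · exact h2 j (Nat.lt_succ_iff.1 hlt) hj
    · rwa [heq] at hvj

/-- The fire up to round `i` depends only on which sets are protected after each number of
placements, so two strategies of different lengths can be compared. -/
theorem burning_congr {k m : ℕ} {h : Fin k → V} {e : Fin m → V} {i : ℕ}
    (hh : ∀ i' ≤ i, ∀ v, (∃ j : Fin k, j.val < i' ∧ h j = v) ↔ ∃ j : Fin m, j.val < i' ∧ e j = v) :
    burning G s h i = burning G s e i := by
  induction i with
  | zero => rfl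
  | succ i ih =>
    have := ih (fun i' hi' => hh i' (hi'.trans (Nat.le_succ i)))
    simp only [burning, this]
    congr 1
    ext v
    refine and_congr Iff.rfl ?_
    have h1 := not_congr (hh _ le_rfl v)
    push Not at h1
    simpa only [Nat.lt_succ_iff] using h1

/-- A shorter strategy is padded by protecting its first vertex again, which is valid since a
protected vertex never burns. The empty strategy has no first vertex; then `C` is empty and any
vertex other than `s` will do, whence `Nontrivial V`. -/
theorem IsParentMap.sacs_of_saves [Nontrivial V] (hp : IsParentMap G s par) {k m : ℕ} (hm : m ≤ k)
    {e : Fin m → V} (hsave : Saves G s C e) : SACS G s C k := by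
  rcases Nat.eq_zero_or_pos m with rfl | hm0
  · obtain ⟨v, hv⟩ := exists_ne s
    have hC : C = ∅ := by
      rw [Set.eq_empty_iff_forall_notMem]
      intro c hc
      obtain ⟨u, ⟨j, -⟩, -⟩ := (hp.isSeparator_iff.1 hsave.2).2.2 c hc
      exact j.elim0
    subst hC
    refine ⟨fun _ => v, fun i => mem_burning_of_protected ⟨0, i.pos⟩ rfl (by simpa [burning] using hv)
      (Nat.zero_le _), hp.isSeparator_iff.2 ⟨?_, by simp, by simp⟩⟩
    rintro ⟨_, h⟩
    exact hv h
  · let h : Fin k → V := fun i => if hi : i.val < m then e ⟨i, hi⟩ else e ⟨0, hm0⟩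
    have hr : Set.range h = Set.range e := by
      apply Set.Subset.antisymm
      · rintro _ ⟨i, rfl⟩
        by_cases hi : i.val < m <;> simp [h, hi]
      · rintro _ ⟨i, rfl⟩
        exact ⟨⟨i, i.2.trans_le hm⟩, by simp [h]⟩
    have hb : ∀ i, i < m → ∀ v, (∃ j : Fin k, j.val < i ∧ h j = v) ↔
        ∃ j : Fin m, j.val < i ∧ e j = v := by
      intro i hi v
      constructor
      · rintro ⟨j, hj, rfl⟩
        exact ⟨⟨j, hj.trans hi⟩, hj, by simp [h, hj.trans hi]⟩
      · rintro ⟨j, hj, rfl⟩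
        exact ⟨⟨j, j.2.trans_le hm⟩, hj, by simp [h]⟩
    refine ⟨h, fun i => ?_, hr ▸ hsave.2⟩
    by_cases hi : i.val < m
    · have := hsave.1 ⟨i, hi⟩
      rw [burning_congr (fun i' hi' => hb i' (hi'.trans_lt hi))]
      simpa [h, hi] using this
    · have h0 := hsave.1 ⟨0, hm0⟩
      refine mem_burning_of_protected ⟨0, i.pos⟩ ?_ ?_ (Nat.zero_le _)
      · simp [h, hi, hm0]
      · simpa [burning, h, hi] using h0

/-- A set that cuts off `C` has at least as many elements as there are tight vertices that it leaves
uncovered. -/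
theorem IsParentMap.ncard_open_le [Finite V] (hp : IsParentMap G s par) {I : Set V}
    (hIC : Disjoint I C) (hcut : ∀ c ∈ C, ∃ u ∈ I, IsAnc par u c) :
    {v | IsTight par s C v ∧ ∀ u ∈ I, ¬ IsAnc par u v}.ncard ≤ I.ncard := by
  induction hn : {v | IsTight par s C v ∧ ∀ u ∈ I, ¬ IsAnc par u v}.ncard generalizing I with
  | zero => exact Nat.zero_le _
  | succ n ih =>
    have hne : {v | IsTight par s C v ∧ ∀ u ∈ I, ¬ IsAnc par u v}.Nonempty := by
      rw [← Set.ncard_pos]; omega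
    -- For a deepest uncovered tight `v`, tightness gives two distinct members `w`, `w'` of `I`
    -- below it: `w` alone does not cut off all of `C` below `v`.
    obtain ⟨v, ⟨hvt, hvI⟩, hmax⟩ := Set.exists_max_image _ (G.dist s) (Set.toFinite _) hne
    have hbelow : ∀ c ∈ C, IsAnc par v c → ∃ u ∈ I, IsAnc par u c ∧ IsAnc par v u := by
      intro c hc hvc
      obtain ⟨u, hu, huc⟩ := hcut c hc
      exact ⟨u, hu, huc, (hp.total hvc huc).resolve_right (hvI u hu)⟩
    obtain ⟨c, hc, hvc⟩ := hvt.2.2.1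
    obtain ⟨w, hw, hwc, hvw⟩ := hbelow c hc hvc
    obtain ⟨c', hc', hvc', hwc'⟩ := hvt.2.2.2 w (by rintro rfl; exact hvI w hw (IsAnc.refl _ _))
      (Set.disjoint_left.1 hIC hw) hvw
    obtain ⟨w', hw', hwc'', hvw'⟩ := hbelow c' hc' hvc'
    -- Replacing all members below `v` by `v` itself shrinks `I` by at least one and uncovers
    -- nothing new; as `v` is deepest, it is the only vertex that becomes covered.
    set I' : Set V := insert v {u | u ∈ I ∧ ¬ IsAnc par v u} with hI'
    have hopen : {x | IsTight par s C x ∧ ∀ u ∈ I', ¬ IsAnc par u x} =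
        {x | IsTight par s C x ∧ ∀ u ∈ I, ¬ IsAnc par u x} \ {v} := by
      ext x
      constructor
      · rintro ⟨h1, h2⟩
        have hvx := h2 v (Set.mem_insert _ _)
        refine ⟨⟨h1, fun u hu hux => ?_⟩, by rintro rfl; exact hvx (IsAnc.refl _ _)⟩
        by_cases hvu : IsAnc par v u
        · exact hvx (hvu.trans hux)
        · exact h2 u (Set.mem_insert_of_mem _ ⟨hu, hvu⟩) hux
      · rintro ⟨⟨h1, h2⟩, h3⟩
        refine ⟨h1, fun u hu hux => ?_⟩
        rcases hu with rfl | hu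
        · exact h3 (hp.eq_of_isAnc hux (hmax x ⟨h1, h2⟩)).symm
        · exact h2 u hu.1 hux
    have hcard : I'.ncard + 1 ≤ I.ncard := by
      have h1 : I'.ncard ≤ {u | u ∈ I ∧ ¬ IsAnc par v u}.ncard + 1 := Set.ncard_insert_le _ _
      have h2 : ({w, w'} ∪ {u | u ∈ I ∧ ¬ IsAnc par v u}).ncard ≤ I.ncard :=
        Set.ncard_le_ncard (by
          rintro x ((rfl | rfl) | hx)
          exacts [hw, hw', hx.1]) (Set.toFinite _)
      rw [Set.ncard_union_eq, Set.ncard_pair] at h2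
      · omega
      · rintro rfl; exact hwc' hwc''
      · rw [Set.disjoint_left]
        rintro x (rfl | rfl) hx
        exacts [hx.2 hvw, hx.2 hvw']
    have := ih (I := I') ?_ ?_ ?_
    · omega
    · rw [Set.disjoint_left]
      rintro x (rfl | hx)
      exacts [hvt.2.1, Set.disjoint_left.1 hIC hx.1]
    · intro c hc
      by_cases hvc : IsAnc par v c
      · exact ⟨v, Set.mem_insert _ _, hvc⟩
      · obtain ⟨u, hu, huc⟩ := hcut c hc
        exact ⟨u, Set.mem_insert_of_mem _ ⟨hu, fun h => hvc (h.trans huc)⟩, huc⟩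
    · have hmem : v ∈ {x | IsTight par s C x ∧ ∀ u ∈ I, ¬ IsAnc par u x} := ⟨hvt, hvI⟩
      rw [hopen, Set.ncard_sdiff_singleton_of_mem hmem]; omega

/-- Exhaustive search through the important separators is complete and sound. -/
theorem SimpleGraph.IsTree.sacs_iff_important [Finite V] (hG : G.IsTree) (s : V) (C : Set V) (k : ℕ) :
    (SACS G s C k → ∃ I : Set V, IsImportantSeparator G {s} C I ∧ I.ncard ≤ k ∧
      (∃ e : Fin I.ncard → V, IsIncreasingListing G s I e) ∧
      ∀ e : Fin I.ncard → V, IsIncreasingListing G s I e → Saves G s C e) ∧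
    (∀ I : Set V, IsImportantSeparator G {s} C I →
      ∀ (m : ℕ) (h : Fin m → V), Set.range h = I → Saves G s C h →
        ∀ e : Fin I.ncard → V, IsIncreasingListing G s I e → Saves G s C e) ∧
    (Nontrivial V →
      ∀ I : Set V, IsImportantSeparator G {s} C I → I.ncard ≤ k →
        ∀ e : Fin I.ncard → V, IsIncreasingListing G s I e → Saves G s C e → SACS G s C k) := by
  obtain ⟨par, hp⟩ := hG.exists_isParentMap s
  refine ⟨?_, fun I hI m h hr hsave e he => ?_, fun _ I hI hk e he hsave => hp.sacs_of_saves hk hsave⟩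
  · rintro ⟨h, hsave⟩
    obtain ⟨I, hI, hk, hτ⟩ := hp.exists_isTightCut hsave
    exact ⟨I, hI.isImportantSeparator hp, hk, exists_isIncreasingListing G s I, fun e he =>
      hp.saves_of_lt_dist (he.2.1.symm ▸ hI.isSeparator hp) (hτ.lt_dist he)⟩
  · exact hp.saves_of_lt_dist (he.2.1.symm ▸ hI.1.1) ((hp.isTimely_of_saves hI.1 hr hsave).lt_dist he)

end RootedTree

/-! ## Guided greedy selection -/

section Guided

variable {V : Type*} {G : SimpleGraph V} {s : V} {par : V → V} {C : Set V} {M k : ℕ}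

/-- The state of a greedy selection that is guided by the binary digits of `guide / M`. -/
structure Selection (V : Type*) where
  guide : ℕ
  sel : List V
  fail : ℕ

open Classical in
/-- Process the vertex `v`: unless it is cut off already, select it if it is tight, the next digit
is `1` and there is time left. -/
noncomputable def Selection.step (G : SimpleGraph V) (s : V) (par : V → V) (C : Set V) (M k : ℕ)
    (st : Selection V) (v : V) : Selection V :=
  if ∃ u ∈ st.sel, IsAnc par u v then st
  else if v ∈ C then ⟨st.guide, st.sel, 1⟩
  else if IsTight par s C v then
    if M ≤ st.guide + st.guide then
      if st.sel.length < G.dist s v ∧ st.sel.length < k then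
        ⟨st.guide + st.guide - M, st.sel ++ [v], st.fail⟩
      else ⟨st.guide + st.guide - M, st.sel, st.fail⟩
    else ⟨st.guide + st.guide, st.sel, st.fail⟩
  else st

/-- The invariant that holds whatever the guide is. With `fail = 0` and all of `C` processed, it
makes the selection a tight cut whose listed order respects the deadlines. -/
structure Selection.IsSound (G : SimpleGraph V) (s : V) (par : V → V) (C : Set V) (k : ℕ)
    (done : Set V) (st : Selection V) : Prop where
  tight : ∀ v ∈ st.sel, IsTight par s C v
  antichain : ∀ u ∈ st.sel, ∀ v ∈ st.sel, IsAnc par u v → u = v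
  nodup : st.sel.Nodup
  sorted : st.sel.Pairwise fun u v => G.dist s u ≤ G.dist s v
  lt_dist : ∀ (i : ℕ) (h : i < st.sel.length), i < G.dist s st.sel[i]
  length_le : st.sel.length ≤ k
  cut : st.fail = 0 → ∀ c ∈ C, c ∈ done → ∃ u ∈ st.sel, IsAnc par u c

theorem Selection.isSound_step (hp : IsParentMap G s par) {done : Set V} {st : Selection V} {v : V}
    (h : st.IsSound G s par C k done) (hv : ∀ u ∈ st.sel, G.dist s u ≤ G.dist s v) :
    (st.step G s par C M k v).IsSound G s par C k (insert v done) ∧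
      ∀ u ∈ (st.step G s par C M k v).sel, u = v ∨ u ∈ st.sel := by
  have hnot : ∀ y, v ∉ C → Selection.IsSound G s par C k (insert v done) ⟨y, st.sel, st.fail⟩ :=
    fun y hvC => { h with
      cut := fun hf c hc hcd => h.cut hf c hc (hcd.resolve_left fun h => hvC (h ▸ hc)) }
  unfold Selection.step
  split_ifs with h1 h2 h3 h4 h5
  · refine ⟨{ h with cut := ?_ }, fun u hu => Or.inr hu⟩
    rintro hf c hc (rfl | hcd)
    · exact h1
    · exact h.cut hf c hc hcd
  · exact ⟨{ h with cut := fun hf => absurd hf one_ne_zero }, fun u hu => Or.inr hu⟩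
  · refine ⟨⟨?_, ?_, ?_, ?_, ?_, ?_, ?_⟩, ?_⟩
    · intro u hu
      rcases List.mem_append.1 hu with hu | hu
      · exact h.tight u hu
      · rwa [List.mem_singleton.1 hu]
    · intro u hu w hw huw
      simp only [List.mem_append, List.mem_singleton] at hu hw
      rcases hu with hu | rfl <;> rcases hw with hw | rfl
      · exact h.antichain u hu w hw huw
      · exact absurd ⟨u, hu, huw⟩ h1
      · exact hp.eq_of_isAnc huw (hv w hw)
      · rfl
    · refine List.nodup_append.2 ⟨h.nodup, List.nodup_singleton _, ?_⟩
      rintro u hu w hw rfl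
      exact h1 ⟨u, hu, List.mem_singleton.1 hw ▸ IsAnc.refl _ _⟩
    · refine List.pairwise_append.2 ⟨h.sorted, List.pairwise_singleton _ _, fun u hu w hw => ?_⟩
      rw [List.mem_singleton.1 hw]
      exact hv u hu
    · intro i hi
      by_cases hi' : i < st.sel.length
      · rw [List.getElem_append_left hi']
        exact h.lt_dist i hi'
      · obtain rfl : i = st.sel.length := by simp at hi; omega
        simpa using h5.1
    · simp only [List.length_append, List.length_singleton]; exact h5.2
    · rintro hf c hc (rfl | hcd)
      · exact absurd hc h2
      · obtain ⟨u, hu, huc⟩ := h.cut hf c hc hcd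
        exact ⟨u, List.mem_append_left _ hu, huc⟩
    · intro u hu
      simpa [or_comm] using hu
  · exact ⟨hnot _ h2, fun u hu => Or.inr hu⟩
  · exact ⟨hnot _ h2, fun u hu => Or.inr hu⟩
  · exact ⟨hnot _ h2, fun u hu => Or.inr hu⟩

theorem Selection.isSound_foldl (hp : IsParentMap G s par) {l : List V}
    (hl : l.Pairwise fun u v => G.dist s u ≤ G.dist s v) {done : Set V} {st : Selection V}
    (h : st.IsSound G s par C k done) (hv : ∀ u ∈ st.sel, ∀ v ∈ l, G.dist s u ≤ G.dist s v) :
    (l.foldl (Selection.step G s par C M k) st).IsSound G s par C k (done ∪ {v | v ∈ l}) := by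
  induction l generalizing st done with
  | nil => simpa using h
  | cons v l ih =>
    obtain ⟨h1, h2⟩ := Selection.isSound_step (M := M) hp h fun u hu => hv u hu v (by simp)
    have := ih (List.pairwise_cons.1 hl).2 h1 fun u hu w hw => by
      rcases h2 u hu with rfl | hu
      · exact (List.pairwise_cons.1 hl).1 w hw
      · exact hv u hu w (by simp [hw])
    rw [List.foldl_cons]
    convert this using 1
    ext w
    simp only [Set.mem_union, Set.mem_insert_iff, Set.mem_ofPred_eq, List.mem_cons]
    tauto

theorem Selection.IsSound.isTightCut {done : Set V} {st : Selection V}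
    (h : st.IsSound G s par C k done) (hC : C ⊆ done) (hf : st.fail = 0) :
    IsTightCut par s C {v | v ∈ st.sel} :=
  ⟨h.tight, h.antichain, fun c hc => h.cut hf c hc (hC hc)⟩

theorem Selection.IsSound.isIncreasingListing {done : Set V} {st : Selection V}
    (h : st.IsSound G s par C k done) : IsIncreasingListing G s {v | v ∈ st.sel} st.sel.get := by
  refine ⟨List.nodup_iff_injective_get.1 h.nodup, by ext v; simp [List.mem_iff_get], ?_⟩
  intro i j hij
  rcases hij.lt_or_eq with hij | rfl
  · exact List.pairwise_iff_get.1 h.sorted i j hij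
  · exact le_rfl

theorem Selection.isSound_init (y : ℕ) : Selection.IsSound G s par C k ∅ ⟨y, [], 0⟩ := by
  constructor <;> simp

/-- The leading binary digits of `y / M`. -/
def HasDigits (M : ℕ) : ℕ → List Bool → Prop
  | _, [] => True
  | y, b :: bs => (b = true ↔ M ≤ y + y) ∧ HasDigits M (if b then y + y - M else y + y) bs

/-- Built from the last digit backwards: prepending `b` halves `y` and adds `2 ^ (r - 1)` if `b` is
`1`. The divisibility clause keeps the halving exact. -/
theorem exists_hasDigits {r : ℕ} (bs : List Bool) (h : bs.length ≤ r) :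
    ∃ y < 2 ^ r, 2 ^ (r - bs.length) ∣ y ∧ HasDigits (2 ^ r) y bs := by
  induction bs with
  | nil => exact ⟨0, by positivity, dvd_zero _, trivial⟩
  | cons b bs ih =>
    simp only [List.length_cons] at h
    obtain ⟨y, hy, hdvd, hd⟩ := ih (by omega)
    have e1 : 2 ^ (r - bs.length) = 2 ^ (r - (bs.length + 1)) * 2 := by
      rw [← pow_succ]; congr 1; omega
    have e2 : 2 ^ r = 2 ^ (r - (bs.length + 1)) * 2 * 2 ^ bs.length := by
      rw [← pow_succ, ← pow_add]; congr 1; omega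
    rw [e1] at hdvd
    obtain ⟨z, rfl⟩ := hdvd
    set q := 2 ^ (r - (bs.length + 1)) with hq
    rcases b with _ | _
    · refine ⟨q * z, ?_, ⟨z, by simp [q]⟩, ?_, ?_⟩
      · have := Nat.mul_le_mul_right z (show q ≤ q * 2 by omega); omega
      · simp only [Bool.false_eq_true, false_iff, not_le]
        calc q * z + q * z = q * 2 * z := by ring
          _ < _ := hy
      · rw [show q * 2 * z = q * z + q * z by ring] at hd
        simpa using hd
    · have e3 : q * z + q * 2 ^ bs.length + (q * z + q * 2 ^ bs.length) = q * 2 * z + 2 ^ r := by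
        rw [e2]; ring
      refine ⟨q * z + q * 2 ^ bs.length, ?_, ?_, ?_, ?_⟩
      · omega
      · simp only [List.length_cons, ← hq]
        exact ⟨z + 2 ^ bs.length, by ring⟩
      · simp only [true_iff]; omega
      · simp only [if_true, e3, Nat.add_sub_cancel]; exact hd

/-- Invariant: the selection is the part of `I` already processed. Digits are consumed exactly at
the tight vertices with no proper ancestor in `I`, and if each says whether its vertex is in `I`,
the run reproduces `I` and never meets a vertex of `C` that is not cut off. -/
theorem Selection.fail_foldl (hp : IsParentMap G s par) {I : Set V} [DecidablePred (· ∈ I)]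
    [DecidablePred fun v => IsTight par s C v ∧ ∀ u ∈ I, IsAnc par u v → u = v] [Finite V]
    (hI : IsTightCut par s C I) (hk : I.ncard ≤ k) (hτ : IsTimely G s I) {l : List V}
    (hl : l.Pairwise fun u v => G.dist s u ≤ G.dist s v) (hnd : l.Nodup) {st : Selection V}
    (hf : st.fail = 0) (hst : ∀ u, u ∈ st.sel ↔ u ∈ I ∧ u ∉ l) (hsnd : st.sel.Nodup)
    (hv : ∀ u ∈ st.sel, ∀ v ∈ l, G.dist s u ≤ G.dist s v)
    (hd : HasDigits M st.guide ((l.filter fun v => IsTight par s C v ∧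
      ∀ u ∈ I, IsAnc par u v → u = v).map fun v => decide (v ∈ I))) :
    (l.foldl (Selection.step G s par C M k) st).fail = 0 := by
  classical
  induction l generalizing st with
  | nil => exact hf
  | cons v l ih =>
    rw [List.foldl_cons]
    have hvl : v ∉ l := (List.nodup_cons.1 hnd).1
    have hl' := List.pairwise_cons.1 hl
    have hblock : (∃ u ∈ st.sel, IsAnc par u v) ↔ ∃ u ∈ I, IsAnc par u v ∧ u ≠ v := by
      constructor
      · rintro ⟨u, hu, huv⟩
        exact ⟨u, ((hst u).1 hu).1, huv, fun h => ((hst u).1 hu).2 (by simp [h])⟩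
      · rintro ⟨u, hu, huv, hne⟩
        refine ⟨u, (hst u).2 ⟨hu, fun hmem => ?_⟩, huv⟩
        rcases List.mem_cons.1 hmem with h | h
        · exact hne h
        · exact hne (hp.eq_of_isAnc huv (hl'.1 u h))
    have hkeep : v ∉ I → ∀ u, u ∈ st.sel ↔ u ∈ I ∧ u ∉ l := by
      intro hvI u
      rw [hst u, List.mem_cons, not_or]
      exact ⟨fun h => ⟨h.1, h.2.2⟩, fun h => ⟨h.1, fun huv => hvI (huv ▸ h.1), h.2⟩⟩
    have hnoblock : v ∈ I → ¬ ∃ u ∈ st.sel, IsAnc par u v := fun hvI h => by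
      obtain ⟨u, hu, huv, hne⟩ := hblock.1 h
      exact hne (hI.antichain u hu v hvI huv)
    have hv' : ∀ u ∈ st.sel, ∀ v ∈ l, G.dist s u ≤ G.dist s v :=
      fun u hu w hw => hv u hu w (by simp [hw])
    unfold Selection.step
    split_ifs with h1 h2 h3 h4 h5
    · refine ih hl'.2 (List.nodup_cons.1 hnd).2 hf (hkeep fun hvI => hnoblock hvI h1) hsnd hv' ?_
      rwa [List.filter_cons_of_neg] at hd
      obtain ⟨u, hu, huv, hne⟩ := hblock.1 h1
      simp only [decide_eq_true_eq, not_and]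
      exact fun _ h => hne (h u hu huv)
    · obtain ⟨u, hu, huv⟩ := hI.cut v h2
      exact absurd (hblock.2 ⟨u, hu, huv, fun h => (hI.tight u hu).2.1 (h ▸ h2)⟩) h1
    all_goals
      first
      | have hneed : IsTight par s C v ∧ ∀ u ∈ I, IsAnc par u v → u = v :=
          ⟨h3, fun u hu huv => by_contra fun hne => h1 (hblock.2 ⟨u, hu, huv, hne⟩)⟩
        rw [List.filter_cons_of_pos (by simpa using hneed), List.map_cons, HasDigits] at hd
        obtain ⟨hd1, hd2⟩ := hd
      | skip
    · have hvI : v ∈ I := by simpa [h4] using hd1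
      refine ih hl'.2 (List.nodup_cons.1 hnd).2 hf ?_ ?_ ?_ ?_
      · intro u
        simp only [List.mem_append, hst u, List.mem_cons, not_or, List.not_mem_nil, or_false]
        constructor
        · rintro (h | rfl)
          exacts [⟨h.1, h.2.2⟩, ⟨hvI, hvl⟩]
        · rintro ⟨h, h'⟩
          by_cases huv : u = v
          exacts [Or.inr huv, Or.inl ⟨h, huv, h'⟩]
      · refine List.nodup_append.2 ⟨hsnd, List.nodup_singleton _, ?_⟩
        rintro u hu w hw rfl
        exact h1 ⟨u, hu, List.mem_singleton.1 hw ▸ IsAnc.refl _ _⟩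
      · intro u hu w hw
        rcases List.mem_append.1 hu with hu | hu
        · exact hv' u hu w hw
        · rw [List.mem_singleton.1 hu]; exact hl'.1 w hw
      · simpa [hvI] using hd2
    · have hvI : v ∈ I := by simpa [h4] using hd1
      -- A member of `I` is never refused: it and the earlier selections have distinct times below
      -- its distance, and together they number at most `|I| ≤ k`.
      refine absurd ?_ h5
      have hnd' : (v :: st.sel).Nodup :=
        List.nodup_cons.2 ⟨fun h => ((hst v).1 h).2 (by simp), hsnd⟩
      have hsub : ∀ u ∈ (v :: st.sel).toFinset, u ∈ I ∧ G.dist s u ≤ G.dist s v := by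
        intro u hu
        rcases List.mem_cons.1 (List.mem_toFinset.1 hu) with rfl | hu
        · exact ⟨hvI, le_rfl⟩
        · exact ⟨((hst u).1 hu).1, hv u hu v (by simp)⟩
      have hcard := List.toFinset_card_of_nodup hnd'
      rw [List.length_cons] at hcard
      constructor
      · obtain ⟨τ, hτ1, hτ2⟩ := hτ
        have := Finset.card_le_card_of_injOn (s := (v :: st.sel).toFinset)
          (t := Finset.range (G.dist s v)) τ
          (fun u hu => by
            have := hsub u hu
            simpa using (hτ2 u this.1).trans_le this.2)
          (fun u hu w hw huw => hτ1 (hsub u hu).1 (hsub w hw).1 huw)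
        rw [hcard, Finset.card_range] at this
        exact this
      · have := Set.ncard_le_ncard (s := ((v :: st.sel).toFinset : Set V)) (t := I)
          (fun u hu => (hsub u hu).1) (Set.toFinite _)
        rw [Set.ncard_coe_finset, hcard] at this
        omega
    · have hvI : v ∉ I := by simpa [h4] using hd1
      exact ih hl'.2 (List.nodup_cons.1 hnd).2 hf (hkeep hvI) hsnd hv' (by simpa [hvI] using hd2)
    · refine ih hl'.2 (List.nodup_cons.1 hnd).2 hf (hkeep fun hvI => h3 (hI.tight v hvI)) hsnd hv' ?_
      rwa [List.filter_cons_of_neg] at hd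
      simp [h3]

theorem IsTightCut.exists_guide [Finite V] (hp : IsParentMap G s par) {I : Set V}
    (hI : IsTightCut par s C I) (hk : I.ncard ≤ k) (hτ : IsTimely G s I) {l : List V}
    (hl : l.Pairwise fun u v => G.dist s u ≤ G.dist s v) (hnd : l.Nodup)
    (hmem : ∀ v, v ≠ s → v ∈ l) :
    ∃ y < 4 ^ k, (l.foldl (Selection.step G s par C (4 ^ k) k) ⟨y, [], 0⟩).fail = 0 := by
  classical
  have h4 : 4 ^ k = 2 ^ (2 * k) := by rw [pow_mul]; norm_num
  set bs := (l.filter fun v => IsTight par s C v ∧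
      ∀ u ∈ I, IsAnc par u v → u = v).map fun v => decide (v ∈ I) with hbs
  have hlen : bs.length ≤ 2 * k := by
    rw [hbs, List.length_map, ← List.toFinset_card_of_nodup (hnd.filter _), ← Set.ncard_coe_finset]
    have hIC : Disjoint I C := Set.disjoint_left.2 fun v hv => (hI.tight v hv).2.1
    have h1 := hp.ncard_open_le hIC hI.cut
    -- The decisions concern members of `I` and tight vertices not covered by `I`, at most `k` of
    -- each.
    refine (Set.ncard_le_ncard (t := I ∪ {v | IsTight par s C v ∧ ∀ u ∈ I, ¬ IsAnc par u v}) ?_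
      (Set.toFinite _)).trans ((Set.ncard_union_le _ _).trans (by omega))
    intro v hv
    simp only [List.coe_toFinset, List.mem_filter, decide_eq_true_eq, Set.mem_ofPred_eq] at hv
    by_cases hvI : v ∈ I
    · exact Or.inl hvI
    · exact Or.inr ⟨hv.2.1, fun u hu huv => hvI (hv.2.2 u hu huv ▸ hu)⟩
  obtain ⟨y, hy, -, hd⟩ := exists_hasDigits bs hlen
  rw [h4]
  refine ⟨y, hy, Selection.fail_foldl hp hI hk hτ hl hnd rfl ?_ List.nodup_nil (by simp) hd⟩
  intro u
  simp only [List.not_mem_nil, false_iff, not_and, not_not]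
  exact fun hu => hmem u (hI.tight u hu).1

end Guided

/-! ## Verification of programs -/

namespace RAM

/-- Started in `σ`, the program `P` halts in a state and after a number of steps that satisfy `Φ`. -/
def wp (P : Prog) (σ : State) (Φ : State → ℕ → Prop) : Prop :=
  ∃ τ t, Runs P σ τ t ∧ Φ τ t

variable {P Q : Prog} {σ : State} {Φ Ψ : State → ℕ → Prop}

theorem wp.mono (h : wp P σ Φ) (hΦ : ∀ τ t, Φ τ t → Ψ τ t) : wp P σ Ψ := by
  obtain ⟨τ, t, h1, h2⟩ := h
  exact ⟨τ, t, h1, hΦ τ t h2⟩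

theorem wp_const (d c : ℕ) : wp (.const d c) σ Φ ↔ Φ (σ.setReg d c) 1 :=
  ⟨by rintro ⟨_, _, ⟨⟩, h⟩; exact h, fun h => ⟨_, _, .const _ _ _, h⟩⟩

theorem wp_add (d a b : ℕ) : wp (.add d a b) σ Φ ↔ Φ (σ.setReg d (σ.reg a + σ.reg b)) 1 :=
  ⟨by rintro ⟨_, _, ⟨⟩, h⟩; exact h, fun h => ⟨_, _, .add _ _ _ _, h⟩⟩

theorem wp_sub (d a b : ℕ) : wp (.sub d a b) σ Φ ↔ Φ (σ.setReg d (σ.reg a - σ.reg b)) 1 :=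
  ⟨by rintro ⟨_, _, ⟨⟩, h⟩; exact h, fun h => ⟨_, _, .sub _ _ _ _, h⟩⟩

theorem wp_load (d a : ℕ) : wp (.load d a) σ Φ ↔ Φ (σ.setReg d (σ.mem (σ.reg a))) 1 :=
  ⟨by rintro ⟨_, _, ⟨⟩, h⟩; exact h, fun h => ⟨_, _, .load _ _ _, h⟩⟩

theorem wp_store (a b : ℕ) : wp (.store a b) σ Φ ↔ Φ (σ.setMem (σ.reg a) (σ.reg b)) 1 :=
  ⟨by rintro ⟨_, _, ⟨⟩, h⟩; exact h, fun h => ⟨_, _, .store _ _ _, h⟩⟩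

theorem wp_seq : wp (.seq P Q) σ Φ ↔ wp P σ fun τ t => wp Q τ fun ρ u => Φ ρ (t + u) := by
  constructor
  · rintro ⟨_, _, ⟨⟩, h⟩
    exact ⟨_, _, ‹_›, _, _, ‹_›, h⟩
  · rintro ⟨τ, t, h1, ρ, u, h2, h⟩
    exact ⟨_, _, .seq h1 h2, h⟩

theorem wp_cond (a : ℕ) : wp (.cond a P Q) σ Φ ↔
    if σ.reg a = 0 then wp Q σ fun τ t => Φ τ (t + 1) else wp P σ fun τ t => Φ τ (t + 1) := by
  split_ifs with ha
  · constructor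
    · rintro ⟨_, _, h1, h⟩
      cases h1 with
      | cond_pos h1 => exact absurd ha h1
      | cond_zero _ h2 => exact ⟨_, _, h2, h⟩
    · rintro ⟨τ, t, h1, h⟩
      exact ⟨_, _, .cond_zero ha h1, h⟩
  · constructor
    · rintro ⟨_, _, h1, h⟩
      cases h1 with
      | cond_pos _ h2 => exact ⟨_, _, h2, h⟩
      | cond_zero h1 => exact absurd h1 ha
    · rintro ⟨τ, t, h1, h⟩
      exact ⟨_, _, .cond_pos ha h1, h⟩

/-- A loop that counts its register down. -/
theorem wp_loop {r : ℕ} (J : ℕ → State → Prop) (T : ℕ) {N : ℕ} (hN : σ.reg r = N) (h0 : J N σ)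
    (hstep : ∀ i τ, i < N → τ.reg r = i + 1 → J (i + 1) τ →
      wp P τ fun ρ t => t ≤ T ∧ ρ.reg r = i ∧ J i ρ) :
    wp (.loop r P) σ fun ρ t => t ≤ N * (T + 1) + 1 ∧ J 0 ρ := by
  induction N generalizing σ with
  | zero => exact ⟨σ, 1, .loop_zero hN, by omega, h0⟩
  | succ N ih =>
    obtain ⟨τ, t, h1, h2, h3, h4⟩ := hstep N σ N.lt_succ_self hN h0
    obtain ⟨ρ, u, h5, h6, h7⟩ := ih h3 h4 fun i τ hi => hstep i τ (hi.trans N.lt_succ_self)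
    refine ⟨ρ, _, .loop_pos (by omega) h1 h5, ?_, h7⟩
    rw [Nat.succ_mul]; omega

/-- Sequences of programs. -/
def block : List Prog → Prog
  -- Clearing the scratch register `30` serves as the instruction that does nothing, at the cost of
  -- one step.
  | [] => .const 30 0
  | [P] => P
  | P :: Q :: L => .seq P (block (Q :: L))

theorem wp_block_nil : wp (block []) σ Φ ↔ Φ (σ.setReg 30 0) 1 := wp_const _ _

theorem wp_block_singleton : wp (block [P]) σ Φ ↔ wp P σ Φ := Iff.rfl

theorem wp_block_cons (L : List Prog) : wp (block (P :: Q :: L)) σ Φ ↔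
    wp P σ fun τ t => wp (block (Q :: L)) τ fun ρ u => Φ ρ (t + u) := wp_seq

theorem reg_setReg (d x r : ℕ) : (σ.setReg d x).reg r = if r = d then x else σ.reg r := by
  simp [State.setReg, Function.update_apply]

theorem mem_setReg (d x : ℕ) : (σ.setReg d x).mem = σ.mem := rfl

theorem reg_setMem (a x : ℕ) : (σ.setMem a x).reg = σ.reg := rfl

theorem mem_setMem (a x b : ℕ) : (σ.setMem a x).mem b = if b = a then x else σ.mem b := by
  simp [State.setMem, Function.update_apply]

theorem setMem_setReg (d x a y : ℕ) : (σ.setReg d x).setMem a y = (σ.setMem a y).setReg d x := rfl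

variable {n : ℕ}

/-- The memory as a matrix with rows of length `n`. -/
def cell (σ : State) (j : ℕ) (v : Fin n) : ℕ := σ.mem (n * j + v.val)

theorem cell_setReg (d x j : ℕ) (v : Fin n) : cell (σ.setReg d x) j v = cell σ j v := rfl

theorem row_col_inj {j j' : ℕ} {v v' : Fin n} :
    n * j + v.val = n * j' + v'.val ↔ j = j' ∧ v = v' := by
  constructor
  · intro h
    have h1 : (n * j + v.val) / n = j := by
      rw [Nat.mul_add_div v.pos, Nat.div_eq_of_lt v.2, add_zero]
    have h2 : (n * j' + v'.val) / n = j' := by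
      rw [Nat.mul_add_div v.pos, Nat.div_eq_of_lt v'.2, add_zero]
    obtain rfl : j = j' := by rw [← h1, h, h2]
    exact ⟨rfl, Fin.ext (Nat.add_left_cancel h)⟩
  · rintro ⟨rfl, rfl⟩; rfl

theorem cell_setMem (j x j' : ℕ) (v v' : Fin n) :
    cell (σ.setMem (n * j + v.val) x) j' v' = if j' = j ∧ v' = v then x else cell σ j' v' := by
  simp only [cell, mem_setMem, row_col_inj]

theorem mem_row_col (j : ℕ) (v : Fin n) : σ.mem (n * j + v.val) = cell σ j v := rfl

theorem mem_val (v : Fin n) : σ.mem v.val = cell σ 0 v := by simp [cell]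

/-- The constants that the program keeps in its first registers: the input, the numbers `1` and `0`,
the bases of the rows `n + 1, …, n + 6` of the memory, and the number of guides. -/
structure Env (n s k : ℕ) (σ : State) : Prop where
  reg0 : σ.reg 0 = n
  reg1 : σ.reg 1 = s
  reg2 : σ.reg 2 = k
  reg3 : σ.reg 3 = 1
  reg4 : σ.reg 4 = n * (n + 1)
  reg5 : σ.reg 5 = n * (n + 2)
  reg6 : σ.reg 6 = n * (n + 3)
  reg7 : σ.reg 7 = n * (n + 4)
  reg8 : σ.reg 8 = n * (n + 5)
  reg9 : σ.reg 9 = n * (n + 6)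
  reg10 : σ.reg 10 = 4 ^ k
  reg11 : σ.reg 11 = 0

theorem env_setMem (s k a x : ℕ) : Env n s k (σ.setMem a x) ↔ Env n s k σ :=
  ⟨fun ⟨h0, h1, h2, h3, h4, h5, h6, h7, h8, h9, h10, h11⟩ =>
    ⟨h0, h1, h2, h3, h4, h5, h6, h7, h8, h9, h10, h11⟩,
  fun ⟨h0, h1, h2, h3, h4, h5, h6, h7, h8, h9, h10, h11⟩ =>
    ⟨h0, h1, h2, h3, h4, h5, h6, h7, h8, h9, h10, h11⟩⟩

theorem env_setReg (s k d x : ℕ) (hd : 12 ≤ d) : Env n s k (σ.setReg d x) ↔ Env n s k σ := by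
  have h : ∀ r < 12, (σ.setReg d x).reg r = σ.reg r := fun r hr => by
    rw [reg_setReg, if_neg (by omega)]
  constructor
  · rintro ⟨h0, h1, h2, h3, h4, h5, h6, h7, h8, h9, h10, h11⟩
    constructor <;> rw [← h _ (by norm_num)] <;> assumption
  · rintro ⟨h0, h1, h2, h3, h4, h5, h6, h7, h8, h9, h10, h11⟩
    constructor <;> rw [h _ (by norm_num)] <;> assumption

/-- The first rows of the memory hold the instance. -/
structure Holds (G : SimpleGraph (Fin n)) (C : Set (Fin n)) (σ : State) : Prop where
  critical : ∀ v : Fin n, cell σ 0 v = 0 ↔ v ∉ C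
  adj : ∀ u v : Fin n, cell σ (u.val + 1) v = 0 ↔ ¬ G.Adj u v

variable {G : SimpleGraph (Fin n)} {C : Set (Fin n)}

theorem holds_setReg (d x : ℕ) : Holds G C (σ.setReg d x) ↔ Holds G C σ :=
  ⟨fun ⟨h1, h2⟩ => ⟨h1, h2⟩, fun ⟨h1, h2⟩ => ⟨h1, h2⟩⟩

theorem holds_setMem (a x : ℕ) (v : Fin n) :
    Holds G C (σ.setMem (n * (n + (a + 1)) + v.val) x) ↔ Holds G C σ := by
  have h : ∀ j ≤ n, ∀ w : Fin n, cell (σ.setMem (n * (n + (a + 1)) + v.val) x) j w = cell σ j w := by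
    intro j hj w
    rw [cell_setMem, if_neg (by omega)]
  constructor
  · rintro ⟨h1, h2⟩
    exact ⟨fun v => by rw [← h1, h _ (Nat.zero_le _)], fun u v => by rw [← h2, h _ u.2]⟩
  · rintro ⟨h1, h2⟩
    exact ⟨fun v => by rw [← h1, h _ (Nat.zero_le _)], fun u v => by rw [← h2, h _ u.2]⟩

attribute [simp] wp_const wp_add wp_sub wp_load wp_store wp_cond wp_block_nil wp_block_singleton
  wp_block_cons reg_setReg mem_setReg reg_setMem setMem_setReg cell_setReg cell_setMem mem_row_col
  mem_val env_setReg env_setMem holds_setReg holds_setMem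

end RAM

namespace RAM

variable {n : ℕ} {σ : State} {G : SimpleGraph (Fin n)} {C : Set (Fin n)} {s : Fin n} {k : ℕ}
  {par : Fin n → Fin n}

/-! ## Parents and distances -/

/-- Row `n + 1` is the distance from `s` plus one, row `n + 2` the parent. -/
structure Rooted (G : SimpleGraph (Fin n)) (s : Fin n) (par : Fin n → Fin n) (σ : State) : Prop where
  dist : ∀ v : Fin n, cell σ (n + 1) v = G.dist s v + 1
  parent : ∀ v : Fin n, cell σ (n + 2) v = (par v).val

/-- An initial part of the search tree has been entered into the rows `n + 1` and `n + 2`. -/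
structure Searched (G : SimpleGraph (Fin n)) (s : Fin n) (par : Fin n → Fin n) (Q : Fin n → Prop)
    (σ : State) : Prop where
  root : cell σ (n + 1) s ≠ 0
  dist : ∀ v : Fin n, cell σ (n + 1) v ≠ 0 → cell σ (n + 1) v = G.dist s v + 1
  parent : ∀ v : Fin n, cell σ (n + 1) v ≠ 0 → cell σ (n + 2) v = (par v).val
  closed : ∀ v : Fin n, cell σ (n + 1) v ≠ 0 → cell σ (n + 1) (par v) ≠ 0
  reached : ∀ v : Fin n, Q v → cell σ (n + 1) v ≠ 0
  zero : ∀ j, 3 ≤ j → ∀ v : Fin n, cell σ (n + j) v = 0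

/-- Registers: `12` rounds left, `13` the scanned vertex `u`, `14` the base of its adjacency row,
`15` its distance plus one, `16` the neighbour tried. Distances are stored plus one so that `0`
means not yet reached. -/
def scanNeighbour : Prog := block [
  .sub 16 16 3, .add 17 14 16, .load 17 17,
  .cond 17 (block [.add 18 4 16, .load 19 18,
    .cond 19 (block []) (block [.add 20 15 3, .store 18 20, .add 18 5 16, .store 18 13])])
    (block [])]

def scanVertex : Prog := block [
  .sub 13 13 3, .sub 14 14 0, .add 15 4 13, .load 15 15,
  .cond 15 (block [.add 16 0 11, .loop 16 scanNeighbour]) (block [])]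

def scanRound : Prog := block [
  .sub 12 12 3, .add 13 0 11, .add 14 4 11, .loop 13 scanVertex]

def search : Prog := block [
  .add 12 4 1, .store 12 3, .add 12 5 1, .store 12 1,
  .add 12 0 11, .loop 12 scanRound]

theorem Searched.setReg {Q : Fin n → Prop} (d x : ℕ) :
    Searched G s par Q (σ.setReg d x) ↔ Searched G s par Q σ :=
  ⟨fun ⟨h1, h2, h3, h4, h5, h6⟩ => ⟨h1, h2, h3, h4, h5, h6⟩,
    fun ⟨h1, h2, h3, h4, h5, h6⟩ => ⟨h1, h2, h3, h4, h5, h6⟩⟩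

theorem Searched.congr {Q Q' : Fin n → Prop} (h : Searched G s par Q σ)
    (hQ : ∀ v, Q' v → Q v ∨ cell σ (n + 1) v ≠ 0) : Searched G s par Q' σ :=
  { h with reached := fun v hv => (hQ v hv).elim (h.reached v) id }

attribute [simp] Searched.setReg

/-- The reached vertices are closed under parents, so an edge from a reached `u` to an unreached `v`
must lead from parent to child. The entries are therefore right in whatever order vertices are
discovered. -/
theorem Searched.insert (hp : IsParentMap G s par) {Q : Fin n → Prop} (h : Searched G s par Q σ)
    {u v : Fin n} (huv : G.Adj u v) (hu : cell σ (n + 1) u ≠ 0) (hv : cell σ (n + 1) v = 0) :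
    Searched G s par (fun w => Q w ∨ w = v)
      ((σ.setMem (n * (n + 1) + v.val) (cell σ (n + 1) u + 1)).setMem (n * (n + 2) + v.val) u.val) := by
  have hne : v ≠ u := by rintro rfl; exact hu hv
  rcases hp.eq_of_adj u v huv with ⟨rfl, hvs⟩ | ⟨rfl, -⟩
  · constructor
    · simp [hvs.symm, h.root]
    · intro w hw
      by_cases hwv : w = v
      · subst hwv
        simp [h.dist _ hu, hp.dist w hvs]
      · simp [hwv] at hw ⊢
        exact h.dist w hw
    · intro w hw
      by_cases hwv : w = v
      · simp [hwv]
      · simp [hwv] at hw ⊢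
        exact h.parent w hw
    · intro w hw
      by_cases hwv : w = v
      · subst hwv
        simp [hu, hne.symm]
      · simp [hwv] at hw ⊢
        have := h.closed w hw
        split_ifs <;> simp_all
    · intro w hw
      by_cases hwv : w = v
      · simp [hwv]
      · simpa [hwv] using h.reached w (hw.resolve_right hwv)
    · intro j hj w
      have h1 : ¬ j = 1 := by omega
      have h2 : ¬ j = 2 := by omega
      simpa [h1, h2] using h.zero j hj w
  · exact absurd hv (h.closed u hu)

theorem wp_scanNeighbour (hp : IsParentMap G s par) {Q : Fin n → Prop} {i u : Fin n} {d : ℕ}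
    (hE : Env n s k σ) (hH : Holds G C σ) (hS : Searched G s par Q σ)
    (h13 : σ.reg 13 = u) (h14 : σ.reg 14 = n * (u + 1)) (h15 : σ.reg 15 = d)
    (h16 : σ.reg 16 = i + 1) (hd : cell σ (n + 1) u = d) (hd0 : d ≠ 0) :
    wp scanNeighbour σ fun τ t => t ≤ 13 ∧ τ.reg 16 = i ∧ Env n s k τ ∧ Holds G C τ ∧
      Searched G s par (fun v => Q v ∨ v = i ∧ G.Adj u v) τ ∧
      τ.reg 12 = σ.reg 12 ∧ τ.reg 13 = u ∧ τ.reg 14 = n * (u + 1) ∧ τ.reg 15 = d ∧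
      cell τ (n + 1) u = d := by
  simp [scanNeighbour, h13, h14, h15, h16, hE.reg4, hE.reg5, hE.reg3, hE, hH, hd]
  split_ifs with h1 h2
  · refine hS.congr fun v hv => hv.imp_right ?_
    rintro ⟨rfl, h⟩
    exact absurd h ((hH.adj u v).1 h1)
  · have hui : u ≠ i := by rintro rfl; exact hd0 (hd ▸ h2)
    have hadj : G.Adj u i := by_contra fun h => h1 ((hH.adj u i).2 h)
    refine ⟨?_, fun h => absurd h hui⟩
    have := hS.insert hp hadj (hd ▸ hd0) h2
    rw [hd] at this
    exact this.congr fun v hv => Or.inl (hv.imp_right And.left)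
  · refine hS.congr fun v hv => hv.imp_right ?_
    rintro ⟨rfl, -⟩
    exact h2

theorem wp_scanVertex (hp : IsParentMap G s par) {Q : Fin n → Prop} {u : Fin n}
    (hE : Env n s k σ) (hH : Holds G C σ) (hS : Searched G s par Q σ)
    (h13 : σ.reg 13 = u + 1) (h14 : σ.reg 14 = n * (u + 2)) :
    wp scanVertex σ fun τ t => t ≤ 14 * n + 10 ∧ τ.reg 13 = u ∧ Env n s k τ ∧ Holds G C τ ∧
      Searched G s par (fun v => (Q v ∨ cell σ (n + 1) v ≠ 0) ∨ cell σ (n + 1) u ≠ 0 ∧ G.Adj u v) τ ∧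
      τ.reg 12 = σ.reg 12 ∧ τ.reg 14 = n * (u + 1) := by
  have e : n * (u.val + 2) - n = n * (u.val + 1) := by rw [← Nat.mul_sub_one]; rfl
  simp [scanVertex, h13, h14, hE.reg3, hE.reg4, hE.reg0, hE.reg11, hE, hH, e]
  split_ifs with h1
  · refine hS.congr fun v hv => ?_
    simpa [h1] using hv
  · refine (wp_loop (fun i τ => Env n s k τ ∧ Holds G C τ ∧
      Searched G s par (fun v => (Q v ∨ cell σ (n + 1) v ≠ 0) ∨ i ≤ v.val ∧ G.Adj u v) τ ∧
      τ.reg 12 = σ.reg 12 ∧ τ.reg 13 = u ∧ τ.reg 14 = n * (u + 1) ∧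
      τ.reg 15 = cell σ (n + 1) u ∧ cell τ (n + 1) u = cell σ (n + 1) u) 13 (N := n) ?_ ?_ ?_).mono ?_
    · simp
    · simp [hE, hH]
      refine hS.congr fun v hv => ?_
      simpa [v.2.not_ge] using hv
    · rintro i τ hi h16 ⟨g1, g2, g3, g4, g5, g6, g7, g8⟩
      refine (wp_scanNeighbour (i := ⟨i, hi⟩) hp g1 g2 g3 g5 g6 g7 h16 g8 h1).mono ?_
      rintro ρ t ⟨f0, f1, f2, f3, f4, f5, f6, f7, f8, f9⟩
      refine ⟨f0, f1, f2, f3, f4.congr fun v hv => Or.inl ?_, f5.trans g4, f6, f7, f8, f9⟩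
      rcases hv with hv | ⟨hi, hv⟩
      · exact Or.inl (Or.inl hv)
      · rcases hi.lt_or_eq with hi | hi
        · exact Or.inl (Or.inr ⟨hi, hv⟩)
        · exact Or.inr ⟨Fin.ext hi.symm, hv⟩
    · rintro τ t ⟨f0, f1, f2, f3, f4, f5, f6, f7, f8⟩
      refine ⟨by omega, f5, f1, f2, f3.congr fun v hv => Or.inl ?_, f4, f6⟩
      simpa [h1] using hv

theorem wp_scanRound (hp : IsParentMap G s par) {Q : Fin n → Prop} {i : ℕ}
    (hE : Env n s k σ) (hH : Holds G C σ) (hS : Searched G s par Q σ) (h12 : σ.reg 12 = i + 1) :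
    wp scanRound σ fun τ t => t ≤ n * (14 * n + 10 + 1) + 4 ∧ τ.reg 12 = i ∧ Env n s k τ ∧ Holds G C τ ∧
      Searched G s par (fun v => Q v ∨ ∃ u, Q u ∧ G.Adj u v) τ := by
  simp [scanRound, h12, hE.reg3, hE.reg4, hE.reg0, hE.reg11]
  refine (wp_loop (fun j τ => Env n s k τ ∧ Holds G C τ ∧
      Searched G s par (fun v => Q v ∨ ∃ u, j ≤ u.val ∧ Q u ∧ G.Adj u v) τ ∧
      τ.reg 12 = i ∧ τ.reg 14 = n * (j + 1)) (14 * n + 10) (N := n) ?_ ?_ ?_).mono ?_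
  · simp
  · simp [hE, hH]
    refine hS.congr fun v hv => Or.inl (hv.resolve_right ?_)
    rintro ⟨u, hu, -⟩
    exact u.2.not_ge hu
  · rintro j τ hj h13 ⟨g1, g2, g3, g4, g5⟩
    refine (wp_scanVertex (u := ⟨j, hj⟩) hp g1 g2 g3 h13 g5).mono ?_
    rintro ρ t ⟨f0, f1, f2, f3, f4, f5, f6⟩
    refine ⟨f0, f1, f2, f3, f4.congr fun v hv => Or.inl ?_, f5.trans g4, f6⟩
    rcases hv with hv | ⟨u, hu, hQ, huv⟩
    · exact Or.inl (Or.inl (Or.inl hv))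
    · rcases hu.lt_or_eq with hu | rfl
      · exact Or.inl (Or.inl (Or.inr ⟨u, hu, hQ, huv⟩))
      · exact Or.inr ⟨g3.reached u (Or.inl hQ), huv⟩
  · rintro τ t ⟨f0, f1, f2, f3, f4, f5⟩
    refine ⟨by omega, f4, f1, f2, f3.congr fun v hv => Or.inl ?_⟩
    simpa using hv

theorem dist_lt_card (hp : IsParentMap G s par) (v : Fin n) : G.dist s v < n := by
  have hinj : Set.InjOn (fun j => par^[j] v) (Finset.range (G.dist s v + 1)) := by
    intro i hi j hj hij
    have := congrArg (G.dist s) hij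
    simp only [hp.dist_iterate] at this
    simp at hi hj
    omega
  have := Finset.card_le_card_of_injOn (t := Finset.univ) _ (fun _ _ => Finset.mem_univ _) hinj
  simpa using this

theorem wp_search (hp : IsParentMap G s par) (hE : Env n s k σ) (hH : Holds G C σ)
    (h0 : ∀ j, 1 ≤ j → ∀ v : Fin n, cell σ (n + j) v = 0) :
    wp search σ fun τ t => t ≤ n * (n * (14 * n + 10 + 1) + 4 + 1) + 6 ∧ Env n s k τ ∧ Holds G C τ ∧
      Rooted G s par τ ∧ ∀ j, 3 ≤ j → ∀ v : Fin n, cell τ (n + j) v = 0 := by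
  simp [search, hE.reg4, hE.reg1, hE.reg3, hE.reg5, hE.reg0, hE.reg11]
  -- With `i` rounds left, all vertices at distance at most `n - i` have been reached; each round
  -- adds at least one layer, and all distances are below `n`.
  refine (wp_loop (fun i τ => Env n s k τ ∧ Holds G C τ ∧
      Searched G s par (fun v => G.dist s v + i ≤ n) τ) (n * (14 * n + 10 + 1) + 4) (N := n)
      ?_ ?_ ?_).mono ?_
  · simp
  · refine ⟨by simp [hE], by simp [hH], Searched.congr (Q := fun v => v = s) ?_ fun v hv =>
      Or.inl (hp.eq_root_of_dist (by omega))⟩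
    simp only [Searched.setReg]
    constructor
    · simp
    · intro v hv
      by_cases hvs : v = s
      · subst hvs; simp
      · simp [hvs, h0 1] at hv
    · intro v hv
      by_cases hvs : v = s
      · subst hvs; simp [hp.root]
      · simp [hvs, h0 1] at hv
    · intro v hv
      by_cases hvs : v = s
      · subst hvs; simp [hp.root]
      · simp [hvs, h0 1] at hv
    · rintro v rfl
      simp
    · intro j hj v
      have h1 : ¬ j = 1 := by omega
      have h2 : ¬ j = 2 := by omega
      simp [h1, h2, h0 j (by omega)]
  · rintro i τ - h12 ⟨g1, g2, g3⟩
    refine (wp_scanRound hp g1 g2 g3 h12).mono ?_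
    rintro ρ t ⟨f0, f1, f2, f3, f4⟩
    refine ⟨f0, f1, f2, f3, f4.congr fun v hv => ?_⟩
    by_cases hvs : v = s
    · exact Or.inr (hvs ▸ f4.root)
    · have := hp.dist v hvs
      exact Or.inl (Or.inr ⟨par v, by omega, hp.adj v hvs⟩)
  · rintro τ t ⟨f0, f1, f2, f3⟩
    have hall : ∀ v : Fin n, cell τ (n + 1) v ≠ 0 := fun v =>
      f3.reached v (by have := dist_lt_card hp v; omega)
    exact ⟨by omega, f1, f2, ⟨fun v => f3.dist v (hall v), fun v => f3.parent v (hall v)⟩, f3.zero⟩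

/-! ## Tight vertices -/

/-- The constants, the instance and the rooted tree are in place. -/
structure Ready (G : SimpleGraph (Fin n)) (s : Fin n) (C : Set (Fin n)) (k : ℕ)
    (par : Fin n → Fin n) (σ : State) : Prop extends
    Env n s k σ, Holds G C σ, Rooted G s par σ

theorem Ready.setReg (d x : ℕ) (hd : 12 ≤ d) :
    Ready G s C k par (σ.setReg d x) ↔ Ready G s C k par σ :=
  ⟨fun h => ⟨(env_setReg _ _ _ _ hd).1 h.toEnv, (holds_setReg _ _).1 h.toHolds, ⟨h.dist, h.parent⟩⟩,
    fun h => ⟨(env_setReg _ _ _ _ hd).2 h.toEnv, (holds_setReg _ _).2 h.toHolds, ⟨h.dist, h.parent⟩⟩⟩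

theorem Ready.setMem (a x : ℕ) (v : Fin n) :
    Ready G s C k par (σ.setMem (n * (n + (a + 3)) + v.val) x) ↔ Ready G s C k par σ := by
  have h : ∀ j, j < 3 → ∀ w : Fin n,
      cell (σ.setMem (n * (n + (a + 3)) + v.val) x) (n + j) w = cell σ (n + j) w := by
    intro j hj w
    rw [cell_setMem, if_neg (by omega)]
  constructor
  · intro g
    exact ⟨(env_setMem _ _ _ _).1 g.toEnv, (holds_setMem _ _ _).1 g.toHolds,
      ⟨fun w => by rw [← h 1 (by norm_num)]; exact g.dist w,
        fun w => by rw [← h 2 (by norm_num)]; exact g.parent w⟩⟩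
  · intro g
    exact ⟨(env_setMem _ _ _ _).2 g.toEnv, (holds_setMem _ _ _).2 g.toHolds,
      ⟨fun w => by rw [h 1 (by norm_num)]; exact g.dist w,
        fun w => by rw [h 2 (by norm_num)]; exact g.parent w⟩⟩

attribute [simp] Ready.setReg Ready.setMem

/-- During a walk from `c` to the root, register `14` holds the ancestor of `c` at distance `i - 1`
from the root. -/
def AtAncestor (G : SimpleGraph (Fin n)) (s : Fin n) (par : Fin n → Fin n) (c : Fin n) (i : ℕ)
    (σ : State) : Prop :=
  ∃ w : Fin n, σ.reg 14 = w ∧ IsAnc par w c ∧ G.dist s w = i - 1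

theorem isAnc_par {w c : Fin n} (h : IsAnc par w c) : IsAnc par (par w) c :=
  IsAnc.trans ⟨1, rfl⟩ h

theorem dist_par (hp : IsParentMap G s par) (w : Fin n) : G.dist s (par w) = G.dist s w - 1 :=
  hp.dist_iterate w 1

theorem isAnc_and_le_iff (hp : IsParentMap G s par) {v w c : Fin n} {i : ℕ} (hw : IsAnc par w c)
    (hd : G.dist s w = i) :
    IsAnc par v c ∧ i ≤ G.dist s v ↔ (IsAnc par v c ∧ i + 1 ≤ G.dist s v) ∨ v = w := by
  constructor
  · rintro ⟨h1, h2⟩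
    rcases h2.lt_or_eq with h2 | h2
    · exact Or.inl ⟨h1, h2⟩
    · exact Or.inr (hp.eq_of_isAnc (hp.isAnc_of_le h1 hw (by omega)) (by omega))
  · rintro (⟨h1, h2⟩ | rfl)
    · exact ⟨h1, by omega⟩
    · exact ⟨hw, hd.ge⟩

/-- The number of critical vertices below `v`. -/
noncomputable def numBelow (par : Fin n → Fin n) (C : Set (Fin n)) (v : Fin n) : ℕ :=
  {c | c ∈ C ∧ IsAnc par v c}.ncard

/-! ### Counting the critical vertices below each vertex -/

def bumpAncestor : Prog := block [
  .sub 13 13 3, .add 15 6 14, .load 16 15, .add 16 16 3, .store 15 16, .add 15 5 14, .load 14 15]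

def countVertex : Prog := block [
  .sub 12 12 3, .load 13 12,
  .cond 13 (block [.add 13 4 12, .load 13 13, .add 14 12 11, .loop 13 bumpAncestor]) (block [])]

def countBelow : Prog := block [.add 12 0 11, .loop 12 countVertex]

open Classical in
theorem wp_countVertex (hp : IsParentMap G s par) {i : Fin n} (hR : Ready G s C k par σ)
    (h0 : ∀ j, 4 ≤ j → ∀ v : Fin n, cell σ (n + j) v = 0) (h12 : σ.reg 12 = i + 1) :
    wp countVertex σ fun τ t => t ≤ n * 8 + 8 ∧ τ.reg 12 = i ∧ Ready G s C k par τ ∧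
      (∀ j, 4 ≤ j → ∀ v : Fin n, cell τ (n + j) v = 0) ∧
      ∀ v : Fin n, cell τ (n + 3) v = cell σ (n + 3) v + if i ∈ C ∧ IsAnc par v i then 1 else 0 := by
  simp [countVertex, h12, hR.reg3, hR.reg4, hR.reg11, hR, hR.critical, hR.dist]
  split_ifs with hi
  -- The stored distance plus one is the number of vertices on the walk from `i` to `s`, both ends
  -- included; those at distance at least `d` have been counted.
  · refine (wp_loop (fun d τ => Ready G s C k par τ ∧ τ.reg 12 = i ∧ AtAncestor G s par i d τ ∧
      (∀ j, 4 ≤ j → ∀ v : Fin n, cell τ (n + j) v = 0) ∧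
      ∀ v : Fin n, cell τ (n + 3) v = cell σ (n + 3) v +
        if IsAnc par v i ∧ d ≤ G.dist s v then 1 else 0) 7
      (N := G.dist s i + 1) ?_ ?_ ?_).mono ?_
    · simp
    · refine ⟨by simp [hR], by simp, ⟨i, by simp, IsAnc.refl _ _, by simp⟩, by simpa using h0, ?_⟩
      intro v
      rw [if_neg (by rintro ⟨h1, h2⟩; have := hp.dist_le h1; omega)]
      simp
    · rintro d τ hd h13 ⟨g1, g2, ⟨w, h14, hw, hwd⟩, g4, g5⟩
      simp [bumpAncestor, h13, h14, g1.reg3, g1.reg6, g1.reg5, g1, g2, g1.parent]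
      refine ⟨⟨par w, by simp, isAnc_par hw, by rw [dist_par hp, hwd]; simp⟩, ?_, ?_⟩
      · intro j hj v
        rw [if_neg (by omega), g4 j hj]
      · intro v
        simp only [isAnc_and_le_iff hp hw (show G.dist s w = d by simpa using hwd)]
        by_cases hvw : v = w
        · subst hvw
          have hlt : ¬ d + 1 ≤ G.dist s v := by omega
          simp [g5, hlt]
        · simp [hvw, g5]
    · rintro τ t ⟨f0, f1, f2, -, f4, f5⟩
      have := dist_lt_card hp i
      refine ⟨by omega, f2, f1, f4, fun v => ?_⟩
      rw [f5]; simp [hi]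
  · exact ⟨h0, fun v h => absurd h hi⟩

theorem wp_countBelow (hp : IsParentMap G s par) (hR : Ready G s C k par σ)
    (h0 : ∀ j, 3 ≤ j → ∀ v : Fin n, cell σ (n + j) v = 0) :
    wp countBelow σ fun τ t => t ≤ n * (n * 8 + 8 + 1) + 2 ∧ Ready G s C k par τ ∧
      (∀ j, 4 ≤ j → ∀ v : Fin n, cell τ (n + j) v = 0) ∧
      ∀ v : Fin n, cell τ (n + 3) v = numBelow par C v := by
  classical
  simp [countBelow, hR.reg0, hR.reg11]
  refine (wp_loop (fun i τ => Ready G s C k par τ ∧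
      (∀ j, 4 ≤ j → ∀ v : Fin n, cell τ (n + j) v = 0) ∧
      ∀ v : Fin n, cell τ (n + 3) v = {c | (c ∈ C ∧ IsAnc par v c) ∧ i ≤ c.val}.ncard)
      (n * 8 + 8) (N := n) ?_ ?_ ?_).mono ?_
  · simp
  · refine ⟨by simp [hR], fun j hj v => by simpa using h0 j (by omega) v, fun v => ?_⟩
    rw [cell_setReg, h0 3 le_rfl, eq_comm, Set.ncard_eq_zero, Set.eq_empty_iff_forall_notMem]
    exact fun c hc => c.2.not_ge hc.2
  · rintro i τ hi h12 ⟨g1, g2, g3⟩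
    refine (wp_countVertex (i := ⟨i, hi⟩) hp g1 g2 h12).mono ?_
    rintro ρ t ⟨f0, f1, f2, f3, f4⟩
    refine ⟨f0, f1, f2, f3, fun v => ?_⟩
    rw [f4, g3]
    split_ifs with h
    · rw [← Set.ncard_insert_of_notMem (a := (⟨i, hi⟩ : Fin n)) (by simp)]
      congr 1
      ext c
      constructor
      · rintro (rfl | ⟨h1, h2⟩)
        · exact ⟨h, le_rfl⟩
        · exact ⟨h1, by omega⟩
      · rintro ⟨h1, h2⟩
        rcases h2.lt_or_eq with h2 | h2
        · exact Or.inr ⟨h1, h2⟩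
        · exact Or.inl (Fin.ext h2.symm)
    · rw [add_zero]
      congr 1
      ext c
      constructor
      · exact fun ⟨h1, h2⟩ => ⟨h1, by omega⟩
      · rintro ⟨h1, h2⟩
        rcases h2.lt_or_eq with h2 | h2
        · exact ⟨h1, h2⟩
        · obtain rfl : c = ⟨i, hi⟩ := Fin.ext h2.symm
          exact absurd h1 h
  · rintro τ t ⟨f0, f1, f2, f3⟩
    refine ⟨by omega, f1, f2, fun v => ?_⟩
    rw [f3, numBelow]; simp

/-- Equality is tested by adding the two truncated differences, whose sum is `0` exactly for equal
numbers. The walk starts at the parent, so that only proper ancestors are marked. -/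
def markAncestor : Prog := block [
  .sub 13 13 3, .add 15 6 14, .load 15 15, .sub 16 15 17, .sub 15 17 15, .add 16 15 16,
  .cond 16 (block []) (block [.add 15 7 14, .store 15 3]), .add 15 5 14, .load 14 15]

def markAncestors : Prog := block [
  .sub 12 12 3, .load 13 12,
  .cond 13 (block []) (block [.add 13 4 12, .load 13 13, .sub 13 13 3, .add 14 5 12, .load 14 14,
    .add 17 6 12, .load 17 17, .loop 13 markAncestor])]

def markLoose : Prog := block [.add 12 0 11, .loop 12 markAncestors]

/-- Row `n + 3` counts the critical vertices below each vertex. -/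
structure Counted (G : SimpleGraph (Fin n)) (s : Fin n) (C : Set (Fin n)) (k : ℕ)
    (par : Fin n → Fin n) (σ : State) : Prop extends Ready G s C k par σ where
  count : ∀ v : Fin n, cell σ (n + 3) v = numBelow par C v

theorem Counted.setReg (d x : ℕ) (hd : 12 ≤ d) :
    Counted G s C k par (σ.setReg d x) ↔ Counted G s C k par σ :=
  ⟨fun h => ⟨(Ready.setReg _ _ hd).1 h.toReady, h.count⟩,
    fun h => ⟨(Ready.setReg _ _ hd).2 h.toReady, h.count⟩⟩

theorem Counted.setMem (a x : ℕ) (v : Fin n) :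
    Counted G s C k par (σ.setMem (n * (n + (a + 4)) + v.val) x) ↔ Counted G s C k par σ := by
  have h : ∀ w : Fin n,
      cell (σ.setMem (n * (n + (a + 4)) + v.val) x) (n + 3) w = cell σ (n + 3) w := by
    intro w
    rw [cell_setMem, if_neg (by omega)]
  constructor
  · intro g
    exact ⟨(Ready.setMem _ _ _).1 g.toReady, fun w => by rw [← h]; exact g.count w⟩
  · intro g
    exact ⟨(Ready.setMem (a + 1) _ _).2 g.toReady, fun w => by rw [h]; exact g.count w⟩

attribute [simp] Counted.setReg Counted.setMem

/-- A vertex `w` above as many critical vertices as its ancestor `v`. -/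
def Absorbs (par : Fin n → Fin n) (C : Set (Fin n)) (v w : Fin n) : Prop :=
  w ∉ C ∧ w ≠ v ∧ IsAnc par v w ∧ numBelow par C v = numBelow par C w

theorem wp_markAncestors (hp : IsParentMap G s par) {i : Fin n} (hR : Counted G s C k par σ)
    (h0 : ∀ j, 5 ≤ j → ∀ v : Fin n, cell σ (n + j) v = 0) (h12 : σ.reg 12 = i + 1) :
    wp markAncestors σ fun τ t => t ≤ n * 12 + 12 ∧ τ.reg 12 = i ∧ Counted G s C k par τ ∧
      (∀ j, 5 ≤ j → ∀ v : Fin n, cell τ (n + j) v = 0) ∧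
      ∀ v : Fin n, cell τ (n + 4) v = 0 ↔ cell σ (n + 4) v = 0 ∧ ¬ Absorbs par C v i := by
  classical
  simp [markAncestors, h12, hR.reg3, hR.reg4, hR.reg5, hR.reg6, hR, hR.critical, hR.dist,
    hR.parent, hR.count]
  split_ifs with hi
  · exact ⟨h0, fun v _ h => h.1 hi⟩
  · refine (wp_loop (fun d τ => Counted G s C k par τ ∧ τ.reg 12 = i ∧ AtAncestor G s par i d τ ∧
      (∀ j, 5 ≤ j → ∀ v : Fin n, cell τ (n + j) v = 0) ∧ τ.reg 17 = numBelow par C i ∧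
      ∀ v : Fin n, cell τ (n + 4) v = 0 ↔ cell σ (n + 4) v = 0 ∧
        ¬ (v ≠ i ∧ (IsAnc par v i ∧ d ≤ G.dist s v) ∧ numBelow par C v = numBelow par C i)) 11
      (N := G.dist s i) ?_ ?_ ?_).mono ?_
    · simp
    · refine ⟨by simp [hR], by simp, ⟨par i, by simp, isAnc_par (IsAnc.refl _ _),
        dist_par hp i⟩, by simpa using h0, by simp, ?_⟩
      intro v
      have : ¬ (v ≠ i ∧ (IsAnc par v i ∧ G.dist s i ≤ G.dist s v) ∧
          numBelow par C v = numBelow par C i) := fun h => h.1 (hp.eq_of_isAnc h.2.1.1 h.2.1.2)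
      simp only [this, not_false_eq_true, and_true, cell_setReg]
    · rintro d τ hd h13 ⟨g1, g2, ⟨w, h14, hw, hwd⟩, g4, g5, g6⟩
      have hwi : w ≠ i := by rintro rfl; omega
      simp [markAncestor, h13, h14, g1.reg3, g1.reg6, g1.reg7, g1.reg5, g1, g2, g1.parent, g1.count,
        g5]
      have hat : ∀ ρ : State, ρ.reg 14 = par w → AtAncestor G s par i d ρ := fun ρ h =>
        ⟨par w, h, isAnc_par hw, by rw [dist_par hp, hwd]; simp⟩
      have hiff := fun v => isAnc_and_le_iff (v := v) hp hw (show G.dist s w = d by simpa using hwd)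
      split_ifs with h1
      · have heq : numBelow par C w = numBelow par C i := by omega
        refine ⟨hat _ (by simp), fun j hj v => by rw [if_neg (by omega), g4 j hj], fun v => ?_⟩
        by_cases hvw : v = w
        · subst hvw
          simp only [if_true, one_ne_zero, false_iff, not_and, not_forall, not_not]
          exact fun _ => ⟨hwi, hw, by omega, heq⟩
        · have := hiff v
          rw [if_neg hvw, g6]
          tauto
      · refine ⟨hat _ (by simp), g4, fun v => ?_⟩
        by_cases hvw : v = w
        · subst hvw
          have hne : ¬ numBelow par C v = numBelow par C i := by omega
          rw [g6]
          tauto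
        · have := hiff v
          rw [g6]
          tauto
    · rintro τ t ⟨f0, f1, f2, -, f4, -, f5⟩
      have := dist_lt_card hp i
      refine ⟨by omega, f2, f1, f4, fun v => ?_⟩
      rw [f5]
      simp only [Absorbs, hi, not_false_eq_true, true_and, Nat.zero_le, and_true, ne_comm]

theorem wp_markLoose (hp : IsParentMap G s par) (hR : Counted G s C k par σ)
    (h0 : ∀ j, 4 ≤ j → ∀ v : Fin n, cell σ (n + j) v = 0) :
    wp markLoose σ fun τ t => t ≤ n * (n * 12 + 12 + 1) + 2 ∧ Counted G s C k par τ ∧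
      (∀ j, 5 ≤ j → ∀ v : Fin n, cell τ (n + j) v = 0) ∧
      ∀ v : Fin n, cell τ (n + 4) v = 0 ↔ ∀ w, ¬ Absorbs par C v w := by
  simp [markLoose, hR.reg0, hR.reg11]
  refine (wp_loop (fun i τ => Counted G s C k par τ ∧
      (∀ j, 5 ≤ j → ∀ v : Fin n, cell τ (n + j) v = 0) ∧
      ∀ v : Fin n, cell τ (n + 4) v = 0 ↔ ∀ w : Fin n, i ≤ w.val → ¬ Absorbs par C v w)
      (n * 12 + 12) (N := n) ?_ ?_ ?_).mono ?_
  · simp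
  · refine ⟨by simp [hR], fun j hj v => by simpa using h0 j (by omega) v, fun v => ?_⟩
    simp only [cell_setReg, h0 4 le_rfl, true_iff]
    exact fun w hw => absurd hw w.2.not_ge
  · rintro i τ hi h12 ⟨g1, g2, g3⟩
    refine (wp_markAncestors (i := ⟨i, hi⟩) hp g1 g2 h12).mono ?_
    rintro ρ t ⟨f0, f1, f2, f3, f4⟩
    refine ⟨f0, f1, f2, f3, fun v => ?_⟩
    rw [f4, g3]
    constructor
    · rintro ⟨h1, h2⟩ w hw
      rcases hw.lt_or_eq with hw | rfl
      · exact h1 w hw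
      · exact h2
    · exact fun h => ⟨fun w hw => h w (by omega), h _ le_rfl⟩
  · rintro τ t ⟨f0, f1, f2, f3⟩
    exact ⟨by omega, f1, f2, fun v => by simpa using f3 v⟩

/-- If `w` is below `v`, the part of `C` below `w` is contained in the part below `v`, so the two
are equal as soon as their sizes are. Counting therefore decides tightness. -/
theorem isTight_iff (v : Fin n) : IsTight par s C v ↔
    v ≠ s ∧ v ∉ C ∧ numBelow par C v ≠ 0 ∧ ∀ w, ¬ Absorbs par C v w := by
  refine and_congr Iff.rfl (and_congr Iff.rfl (and_congr ?_ (forall_congr' fun w => ?_)))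
  · rw [numBelow, ← Nat.pos_iff_ne_zero, Set.ncard_pos]
    rfl
  · constructor
    · rintro h ⟨h1, h2, h3, h4⟩
      obtain ⟨c, hc, hvc, hwc⟩ := h h2 h1 h3
      refine h4.not_gt (Set.ncard_lt_ncard (Set.ssubset_iff_exists.2
        ⟨fun x hx => ⟨hx.1, h3.trans hx.2⟩, c, ⟨hc, hvc⟩, fun h => hwc h.2⟩))
    · intro h h2 h1 h3
      by_contra! hcon
      refine h ⟨h1, h2, h3, ?_⟩
      unfold numBelow
      congr 1
      ext c
      exact ⟨fun hc => ⟨hc.1, hcon c hc.1 hc.2⟩, fun hc => ⟨hc.1, h3.trans hc.2⟩⟩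

/-! ## Guided selection -/

/-- Row `n + 4` marks the vertices that are not tight although they are above critical vertices. -/
structure Prepared (G : SimpleGraph (Fin n)) (s : Fin n) (C : Set (Fin n)) (k : ℕ)
    (par : Fin n → Fin n) (σ : State) : Prop extends Counted G s C k par σ where
  loose : ∀ v : Fin n, cell σ (n + 4) v = 0 ↔ ∀ w, ¬ Absorbs par C v w

theorem Prepared.setReg (d x : ℕ) (hd : 12 ≤ d) :
    Prepared G s C k par (σ.setReg d x) ↔ Prepared G s C k par σ :=
  ⟨fun h => ⟨(Counted.setReg _ _ hd).1 h.toCounted, h.loose⟩,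
    fun h => ⟨(Counted.setReg _ _ hd).2 h.toCounted, h.loose⟩⟩

theorem Prepared.setMem (a x : ℕ) (v : Fin n) :
    Prepared G s C k par (σ.setMem (n * (n + (a + 5)) + v.val) x) ↔ Prepared G s C k par σ := by
  have h : ∀ w : Fin n,
      cell (σ.setMem (n * (n + (a + 5)) + v.val) x) (n + 4) w = cell σ (n + 4) w := by
    intro w
    rw [cell_setMem, if_neg (by omega)]
  constructor
  · intro g
    exact ⟨(Counted.setMem _ _ _).1 g.toCounted, fun w => by rw [← h]; exact g.loose w⟩
  · intro g
    exact ⟨(Counted.setMem (a + 1) _ _).2 g.toCounted, fun w => by rw [h]; exact g.loose w⟩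

attribute [simp] Prepared.setReg Prepared.setMem

/-- Row `n + 5` carries the stamp `x` on the selected vertices, row `n + 6` lists them. -/
structure Represents (x : ℕ) (st : Selection (Fin n)) (σ : State) : Prop where
  guide : σ.reg 24 = st.guide
  length : σ.reg 22 = st.sel.length
  fail : σ.reg 23 = st.fail
  stamp : σ.reg 26 = x
  mem : ∀ v : Fin n, cell σ (n + 5) v = x ↔ v ∈ st.sel
  -- Guides are tried in decreasing order, so stamps left by earlier attempts exceed `x` and the row
  -- never has to be cleared.
  fresh : ∀ v : Fin n, cell σ (n + 5) v = 0 ∨ x ≤ cell σ (n + 5) v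
  list : ∀ (i : Fin n) (h : i.val < st.sel.length), cell σ (n + 6) i = (st.sel[i.val]).val

theorem Represents.setReg {x : ℕ} {st : Selection (Fin n)} (d y : ℕ) (hd : d < 22) :
    Represents x st (σ.setReg d y) ↔ Represents x st σ := by
  have h : ∀ r, 22 ≤ r → (σ.setReg d y).reg r = σ.reg r := fun r hr => by
    rw [reg_setReg, if_neg (by omega)]
  constructor
  · rintro ⟨h1, h2, h3, h4, h5, h6, h7⟩
    rw [h _ (by norm_num)] at h1 h2 h3 h4
    exact ⟨h1, h2, h3, h4, h5, h6, h7⟩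
  · rintro ⟨h1, h2, h3, h4, h5, h6, h7⟩
    refine ⟨?_, ?_, ?_, ?_, h5, h6, h7⟩ <;> rw [h _ (by norm_num)] <;> assumption

theorem Represents.setReg25 {x : ℕ} {st : Selection (Fin n)} (y : ℕ) :
    Represents x st (σ.setReg 25 y) ↔ Represents x st σ := by
  constructor <;> rintro ⟨h1, h2, h3, h4, h5, h6, h7⟩ <;>
    exact ⟨by simpa using h1, by simpa using h2, by simpa using h3, by simpa using h4, h5, h6, h7⟩

theorem Represents.setReg30 {x : ℕ} {st : Selection (Fin n)} (y : ℕ) :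
    Represents x st (σ.setReg 30 y) ↔ Represents x st σ := by
  constructor <;> rintro ⟨h1, h2, h3, h4, h5, h6, h7⟩ <;>
    exact ⟨by simpa using h1, by simpa using h2, by simpa using h3, by simpa using h4, h5, h6, h7⟩

theorem Represents.congr {x : ℕ} {st : Selection (Fin n)} {τ : State} (h : Represents x st σ)
    (hm : τ.mem = σ.mem) (hr : ∀ r ∈ [22, 23, 24, 26], τ.reg r = σ.reg r) :
    Represents x st τ := by
  have hc : ∀ j (v : Fin n), cell τ j v = cell σ j v := fun j v => by rw [cell, hm]; rfl
  simp only [List.forall_mem_cons] at hr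
  obtain ⟨r1, r2, r3, r4, -⟩ := hr
  exact ⟨r3 ▸ h.guide, r1 ▸ h.length, r2 ▸ h.fail, r4 ▸ h.stamp, fun v => hc _ v ▸ h.mem v,
    fun v => hc _ v ▸ h.fresh v, fun i hi => hc _ i ▸ h.list i hi⟩

attribute [simp] Represents.setReg Represents.setReg25 Represents.setReg30

/-- Registers from here on: `13` the vertex, `20` the guide counter, `21` whether a cut was found,
`22` the number of selected vertices, `23` failure, `24` the guide, `25` the current distance, `26`
the stamp. -/
def select : Prog := block [.add 16 8 13, .store 16 26, .add 16 9 22, .store 16 13, .add 22 22 3]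

def choose : Prog := block [.add 24 24 24, .sub 16 10 24,
  .cond 16 (block []) (block [.sub 24 24 10, .sub 16 25 22,
    .cond 16 (block [.sub 16 2 22, .cond 16 select (block [])]) (block [])])]

def settle : Prog := block [.load 16 13,
  .cond 16 (block [.const 23 1]) (block [.add 16 6 13, .load 16 16,
    .cond 16 (block [.add 16 7 13, .load 16 16, .cond 16 (block []) choose]) (block [])])]

def checkAncestor : Prog := block [.sub 15 15 3, .add 16 8 14, .load 16 16, .sub 17 16 26,
  .sub 16 26 16, .add 16 16 17, .cond 16 (block []) (block [.const 19 1]), .add 16 5 14,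
  .load 14 16]

def process : Prog := block [.add 14 13 11, .const 19 0, .add 15 25 3, .loop 15 checkAncestor,
  .cond 19 (block []) settle]

def visit : Prog := block [.sub 13 13 3, .add 15 4 13, .load 15 15, .sub 15 15 3, .sub 16 15 25,
  .sub 17 25 15, .add 16 16 17, .cond 16 (block []) process]

/-- The distance is increased before the layer is visited, so the first layer is at distance `1` and
`s` is never processed. -/
def level : Prog := block [.sub 12 12 3, .add 25 25 3, .add 13 0 11, .loop 13 visit]

def attempt : Prog := block [.sub 20 20 3,
  .cond 21 (block []) (block [.add 24 20 11, .add 26 20 3, .const 22 0, .const 23 0, .const 25 0,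
    .add 12 0 11, .loop 12 level, .cond 23 (block []) (block [.const 21 1])])]

def exhaust : Prog := block [.add 20 10 11, .const 21 0, .loop 20 attempt]

/-- The registers of the surrounding loops are unchanged. -/
def SameLoops (σ τ : State) : Prop :=
  τ.reg 12 = σ.reg 12 ∧ τ.reg 13 = σ.reg 13 ∧ τ.reg 20 = σ.reg 20 ∧ τ.reg 21 = σ.reg 21 ∧
    τ.reg 25 = σ.reg 25

theorem Represents.select {x y : ℕ} {st : Selection (Fin n)} {v l : Fin n}
    (h : Represents x st σ) (hl : l.val = st.sel.length) :
    Represents x ⟨y, st.sel ++ [v], st.fail⟩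
      ((((σ.setMem (n * (n + 5) + v.val) x).setMem (n * (n + 6) + l.val) v.val).setReg 24 y).setReg
        22 (st.sel.length + 1)) := by
  constructor
  · simp
  · simp
  · simp [h.fail]
  · simp [h.stamp]
  · intro w
    by_cases hw : w = v
    · simp [hw]
    · simp [hw, h.mem]
  · intro w
    by_cases hw : w = v
    · simp [hw]
    · simpa [hw] using h.fresh w
  · intro i hi
    by_cases hil : i = l
    · subst hil
      simp [← hl]
    · have hil' : i.val < st.sel.length := by
        have : i.val ≠ l.val := fun h => hil (Fin.ext h)
        simp at hi
        omega
      simp [hil, List.getElem_append_left hil', h.list i hil']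

theorem wp_settle (hp : IsParentMap G s par) {x : ℕ} {st : Selection (Fin n)} {v : Fin n}
    (hP : Prepared G s C k par σ) (hR : Represents x st σ) (h13 : σ.reg 13 = v)
    (h25 : σ.reg 25 = G.dist s v) (hv : v ≠ s) (hst : ¬ ∃ u ∈ st.sel, IsAnc par u v) :
    wp settle σ fun τ t => t ≤ 22 ∧ Prepared G s C k par τ ∧
      Represents x (st.step G s par C (4 ^ k) k v) τ ∧ SameLoops σ τ := by
  classical
  have ht := isTight_iff (s := s) (par := par) (C := C) v
  unfold Selection.step
  rw [if_neg hst]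
  have hreg : ∀ y, Represents x ⟨y, st.sel, st.fail⟩ (σ.setReg 24 y) := fun y =>
    ⟨by simp, by simpa using hR.length, by simpa using hR.fail, by simpa using hR.stamp, hR.mem,
      hR.fresh, hR.list⟩
  simp [settle, choose, RAM.select, h13, hP, hP.critical, hP.reg3, hP.reg6, hP.reg7, hP.reg8,
    hP.reg9, hP.reg10, hP.reg2, hP.count, hP.loose, hR.guide, hR.length, hR.stamp, h25, SameLoops,
    Nat.sub_eq_zero_iff_le]
  by_cases hC : v ∈ C
  · simp only [hC, if_true]
    exact ⟨by simpa using hR.guide, by simpa using hR.length, by simp, by simpa using hR.stamp,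
      hR.mem, hR.fresh, hR.list⟩
  by_cases hb : numBelow par C v = 0
  · simpa [hC, hb, ht] using hR
  by_cases hl : ∀ w, ¬ Absorbs par C v w
  swap
  · simpa [hC, hb, ht, hl] using hR
  by_cases hM : 4 ^ k ≤ st.guide + st.guide
  swap
  · simp [hC, hb, ht, hl, hM, hv]
    exact (hreg _).congr (by simp) (by simp)
  by_cases hd : G.dist s v ≤ st.sel.length
  · simp [hC, hb, ht, hl, hM, hv, hd, hd.not_gt]
    exact (hreg _).congr (by simp) (by simp)
  by_cases hk : k ≤ st.sel.length
  · simp [hC, hb, ht, hl, hM, hv, hd, hk, hk.not_gt]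
    exact (hreg _).congr (by simp) (by simp)
  simp only [hC, hb, ht, hl, hM, hv, hd, hk, not_le.1 hd, not_le.1 hk, if_true, if_false, ne_eq,
    not_false_eq_true, implies_true, and_true]
  -- The selection is shorter than the distance of `v`, hence than `n`, so the new entry fits into
  -- row `n + 6`.
  obtain ⟨l, hl⟩ : ∃ l : Fin n, l.val = st.sel.length :=
    ⟨⟨_, (not_le.1 hd).trans (dist_lt_card hp v)⟩, rfl⟩
  refine ⟨by simp [← hl, hP], ?_⟩
  exact (hR.select hl).congr (by simp [← hl]) (by simp)

theorem wp_process (hp : IsParentMap G s par) {x : ℕ} {st : Selection (Fin n)} {v : Fin n}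
    (hP : Prepared G s C k par σ) (hR : Represents x st σ) (h13 : σ.reg 13 = v)
    (h25 : σ.reg 25 = G.dist s v) (hv : v ≠ s) :
    wp process σ fun τ t => t ≤ n * 13 + 27 ∧ Prepared G s C k par τ ∧
      Represents x (st.step G s par C (4 ^ k) k v) τ ∧ SameLoops σ τ := by
  simp only [process, wp_block_cons, wp_block_singleton, wp_add, wp_const]
  refine (wp_loop (fun i τ => Prepared G s C k par τ ∧ Represents x st τ ∧ AtAncestor G s par v i τ ∧
    SameLoops σ τ ∧ (τ.reg 19 = 0 ↔ ∀ u ∈ st.sel, ¬ (IsAnc par u v ∧ i ≤ G.dist s u))) 12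
    (N := G.dist s v + 1) ?_ ?_ ?_).mono ?_
  · simp [h25, hP.reg3]
  · refine ⟨by simp [hP], by simp [hR], ⟨v, by simp [h13, hP.reg11], IsAnc.refl _ _, by simp⟩,
      by simp [SameLoops], ?_⟩
    simp only [reg_setReg]
    have : ∀ u ∈ st.sel, ¬ (IsAnc par u v ∧ G.dist s v + 1 ≤ G.dist s u) := fun u _ h => by
      have := hp.dist_le h.1
      omega
    simpa using this
  · rintro i τ hi h15 ⟨g1, g2, ⟨w, h14, hw, hwd⟩, g4, g5⟩
    have hat : ∀ ρ : State, ρ.reg 14 = par w → AtAncestor G s par v i ρ := fun ρ h =>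
      ⟨par w, h, isAnc_par hw, by rw [dist_par hp, hwd]; simp⟩
    have hmem := g2.mem w
    have hsame : ∀ ρ : State, SameLoops τ ρ → SameLoops σ ρ := by
      rintro ρ ⟨e1, e2, e3, e4, e5⟩
      obtain ⟨d1, d2, d3, d4, d5⟩ := g4
      exact ⟨e1.trans d1, e2.trans d2, e3.trans d3, e4.trans d4, e5.trans d5⟩
    simp [checkAncestor, h15, h14, g1.reg3, g1.reg5, g1.reg8, g2.stamp, g1.parent, g1, g2]
    have hiff := fun u => isAnc_and_le_iff (v := u) hp hw (show G.dist s w = i by simpa using hwd)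
    split_ifs with h1
    · refine ⟨hat _ (by simp), hsame _ (by simp [SameLoops]), w, hmem.1 (by omega), hw, ?_⟩
      exact (show G.dist s w = i by simpa using hwd).ge
    · refine ⟨hat _ (by simp), hsame _ (by simp [SameLoops]), ?_⟩
      rw [g5]
      refine forall₂_congr fun u hu => ?_
      have huw : u ≠ w := by
        rintro rfl
        have := hmem.2 hu
        omega
      have hlt : G.dist s u < i ↔ ¬ i ≤ G.dist s u := not_le.symm
      have := hiff u
      tauto
  · rintro τ t ⟨f0, f1, f2, -, f4, f5⟩
    have hlt := dist_lt_card hp v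
    have hblock : τ.reg 19 = 0 ↔ ¬ ∃ u ∈ st.sel, IsAnc par u v := by
      rw [f5]; simp
    rw [wp_cond]
    split_ifs with h1
    · refine (wp_settle hp f1 f2 (f4.2.1.trans h13) (f4.2.2.2.2.trans h25) hv (hblock.1 h1)).mono ?_
      rintro ρ u ⟨e0, e1, e2, e3⟩
      refine ⟨by omega, e1, e2, ?_⟩
      obtain ⟨e1, e2, e3, e4, e5⟩ := e3
      obtain ⟨d1, d2, d3, d4, d5⟩ := f4
      exact ⟨e1.trans d1, e2.trans d2, e3.trans d3, e4.trans d4, e5.trans d5⟩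
    · rw [wp_block_nil]
      refine ⟨by omega, by simpa using f1, ?_, by simpa [SameLoops] using f4⟩
      rw [Selection.step, if_pos (not_not.1 fun h => h1 (hblock.2 h))]
      simpa using f2

/-- The vertices at distance `d` whose number is less than `i`, the largest first. -/
noncomputable def layerBelow (G : SimpleGraph (Fin n)) (s : Fin n) (d : ℕ) : ℕ → List (Fin n)
  | 0 => []
  | i + 1 => if h : i < n then
      if G.dist s ⟨i, h⟩ = d then ⟨i, h⟩ :: layerBelow G s d i else layerBelow G s d i
    else layerBelow G s d i

/-- The vertices whose distance from `s` is among the last `m` values up to `n`, by distance. -/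
noncomputable def lastLayers (G : SimpleGraph (Fin n)) (s : Fin n) : ℕ → List (Fin n)
  | 0 => []
  | m + 1 => layerBelow G s (n - m) n ++ lastLayers G s m

theorem mem_layerBelow {d i : ℕ} {v : Fin n} :
    v ∈ layerBelow G s d i ↔ v.val < i ∧ G.dist s v = d := by
  induction i with
  | zero => simp [layerBelow]
  | succ i ih =>
    have key : v.val < i + 1 ∧ G.dist s v = d ↔
        (v.val = i ∧ G.dist s v = d) ∨ (v.val < i ∧ G.dist s v = d) := by omega
    rw [key, ← ih, layerBelow]
    split_ifs with h1 h2
    · rw [List.mem_cons]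
      refine or_congr_left ⟨?_, fun h => Fin.ext h.1⟩
      rintro rfl
      exact ⟨rfl, h2⟩
    · refine (or_iff_right ?_).symm
      rintro ⟨rfl, h⟩
      exact h2 h
    · refine (or_iff_right ?_).symm
      rintro ⟨rfl, h⟩
      exact h1 v.2

theorem nodup_layerBelow (d i : ℕ) : (layerBelow G s d i).Nodup := by
  induction i with
  | zero => simp [layerBelow]
  | succ i ih =>
    rw [layerBelow]
    split_ifs
    · exact List.nodup_cons.2 ⟨fun h => (mem_layerBelow.1 h).1.ne rfl, ih⟩
    · exact ih
    · exact ih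

theorem mem_lastLayers {m : ℕ} (hm : m ≤ n) {v : Fin n} :
    v ∈ lastLayers G s m ↔ n < G.dist s v + m ∧ G.dist s v ≤ n := by
  induction m with
  | zero => simp [lastLayers]
  | succ m ih =>
    rw [lastLayers, List.mem_append, mem_layerBelow, ih (by omega)]
    have := v.2
    omega

theorem nodup_lastLayers {m : ℕ} (hm : m ≤ n) : (lastLayers G s m).Nodup := by
  induction m with
  | zero => simp [lastLayers]
  | succ m ih =>
    refine List.nodup_append.2 ⟨nodup_layerBelow _ _, ih (by omega), ?_⟩
    rintro v hv w hw rfl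
    have h1 := mem_layerBelow.1 hv
    have h2 := (mem_lastLayers (by omega)).1 hw
    omega

theorem sorted_lastLayers {m : ℕ} (hm : m ≤ n) :
    (lastLayers G s m).Pairwise fun u v => G.dist s u ≤ G.dist s v := by
  induction m with
  | zero => simp [lastLayers]
  | succ m ih =>
    refine List.pairwise_append.2 ⟨?_, ih (by omega), fun v hv w hw => ?_⟩
    · refine List.pairwise_of_forall_mem_list fun u hu v hv => ?_
      rw [(mem_layerBelow.1 hu).2, (mem_layerBelow.1 hv).2]
    · have h1 := mem_layerBelow.1 hv
      have h2 := (mem_lastLayers (by omega)).1 hw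
      omega

theorem wp_level (hp : IsParentMap G s par) {x m : ℕ} {st : Selection (Fin n)} (hm : m < n)
    (hP : Prepared G s C k par σ) (hR : Represents x st σ) (h12 : σ.reg 12 = m + 1)
    (h25 : σ.reg 25 + 1 = n - m) :
    wp level σ fun τ t => t ≤ n * (n * 13 + 35 + 1) + 4 ∧ τ.reg 12 = m ∧ Prepared G s C k par τ ∧
      Represents x ((layerBelow G s (n - m) n).foldl (Selection.step G s par C (4 ^ k) k) st) τ ∧
      τ.reg 25 = n - m ∧ τ.reg 20 = σ.reg 20 ∧ τ.reg 21 = σ.reg 21 := by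
  simp only [level, wp_block_cons, wp_block_singleton, wp_add, wp_sub]
  -- The invariant looks ahead: folding over the vertices still to come leads to the final
  -- selection. Since the counter runs down, these are the ones below `i`.
  refine (wp_loop (fun i τ => Prepared G s C k par τ ∧ (∃ st', Represents x st' τ ∧
      (layerBelow G s (n - m) i).foldl (Selection.step G s par C (4 ^ k) k) st' =
        (layerBelow G s (n - m) n).foldl (Selection.step G s par C (4 ^ k) k) st) ∧
      τ.reg 12 = m ∧ τ.reg 25 = n - m ∧ τ.reg 20 = σ.reg 20 ∧ τ.reg 21 = σ.reg 21) (n * 13 + 35)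
      (N := n) ?_ ?_ ?_).mono ?_
  · simp [hP.reg0, hP.reg11]
  · exact ⟨by simp [hP], ⟨st, by simp [hR], rfl⟩, by simp [h12, hP.reg3], by simp [h25, hP.reg3],
      by simp, by simp⟩
  · rintro i τ hi h13 ⟨g1, ⟨st', g2, g3⟩, g4, g5, g6, g7⟩
    obtain ⟨v, rfl⟩ : ∃ v : Fin n, v.val = i := ⟨⟨i, hi⟩, rfl⟩
    simp [visit, h13, g1.reg3, g1.reg4, g1.dist, g5]
    rw [layerBelow, dif_pos hi] at g3
    split_ifs with h1
    · have hd : G.dist s v = n - m := by omega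
      rw [if_pos hd, List.foldl_cons] at g3
      have hvs : v ≠ s := by rintro rfl; simp at hd; omega
      refine (wp_process (C := C) (k := k) (v := v) (x := x) (st := st') hp (by simp [g1]) (by simp [g2]) (by simp)
        (by simp [g5, hd]) hvs).mono ?_
      rintro ρ t ⟨e0, e1, e2, e3, e4, e5, e6, e7⟩
      simp at e3 e4 e5 e6 e7
      exact ⟨by omega, e4, e1, ⟨_, e2, g3⟩, e3.trans g4, e7.trans g5, e5.trans g6, e6.trans g7⟩
    · have hd : ¬ G.dist s v = n - m := by omega
      rw [if_neg hd] at g3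
      simp [g1, g4, g6, g7]
      exact ⟨st', g2, g3⟩
  · rintro τ t ⟨f0, f1, ⟨st', f2, f3⟩, f4, f5, f6, f7⟩
    refine ⟨by omega, f4, f1, ?_, f5, f6, f7⟩
    rwa [← f3]

/-- The result of the selection guided by `y`. -/
noncomputable def outcome (G : SimpleGraph (Fin n)) (s : Fin n) (par : Fin n → Fin n)
    (C : Set (Fin n)) (k y : ℕ) : Selection (Fin n) :=
  (lastLayers G s n).foldl (Selection.step G s par C (4 ^ k) k) ⟨y, [], 0⟩

/-- Register `22` and row `n + 6` hold a successful selection. -/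
def Found (G : SimpleGraph (Fin n)) (s : Fin n) (par : Fin n → Fin n) (C : Set (Fin n)) (k : ℕ)
    (σ : State) : Prop :=
  ∃ y < 4 ^ k, (outcome G s par C k y).fail = 0 ∧
    σ.reg 22 = (outcome G s par C k y).sel.length ∧
    ∀ (i : Fin n) (h : i.val < (outcome G s par C k y).sel.length),
      cell σ (n + 6) i = ((outcome G s par C k y).sel[i.val]).val

/-- All guides from `i` on have been tried. -/
structure Tried (G : SimpleGraph (Fin n)) (s : Fin n) (par : Fin n → Fin n) (C : Set (Fin n))
    (k i : ℕ) (σ : State) : Prop where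
  fresh : ∀ v : Fin n, cell σ (n + 5) v = 0 ∨ i + 1 ≤ cell σ (n + 5) v
  result : (σ.reg 21 = 0 ∧ ∀ y, i ≤ y → y < 4 ^ k → (outcome G s par C k y).fail ≠ 0) ∨
    (σ.reg 21 = 1 ∧ Found G s par C k σ)

theorem wp_attempt (hp : IsParentMap G s par) {i : ℕ} (hi : i < 4 ^ k) (hP : Prepared G s C k par σ)
    (hT : Tried G s par C k (i + 1) σ) (h20 : σ.reg 20 = i + 1) :
    wp attempt σ fun τ t => t ≤ n * (n * (n * 13 + 35 + 1) + 4 + 1) + 12 ∧ τ.reg 20 = i ∧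
      Prepared G s C k par τ ∧ Tried G s par C k i τ := by
  rw [attempt, wp_block_cons, wp_sub, wp_block_singleton, wp_cond]
  have e21 : (σ.setReg 20 (σ.reg 20 - σ.reg 3)).reg 21 = σ.reg 21 := by simp
  rw [e21]
  rcases hT.result with ⟨h21, hall⟩ | ⟨h21, hfound⟩
  · rw [if_pos h21]
    simp only [wp_block_cons, wp_block_singleton, wp_add, wp_const]
    refine (wp_loop (fun m τ => Prepared G s C k par τ ∧ (∃ st, Represents (i + 1) st τ ∧
      (lastLayers G s m).foldl (Selection.step G s par C (4 ^ k) k) st = outcome G s par C k i) ∧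
      τ.reg 25 = n - m ∧ τ.reg 20 = i ∧ τ.reg 21 = 0) (n * (n * 13 + 35 + 1) + 4)
      (N := n) ?_ ?_ ?_).mono ?_
    · simp [hP.reg0, hP.reg11]
    · refine ⟨by simp [hP], ⟨⟨i, [], 0⟩, ?_, rfl⟩, by simp, by simp [h20, hP.reg3], by simp [h21]⟩
      constructor
      · simp [h20, hP.reg3, hP.reg11]
      · simp
      · simp
      · simp [h20, hP.reg3]
      -- The new stamp `i + 1` is positive and below all earlier stamps, so no vertex counts as
      -- selected at the start.
      · intro v
        have := hT.fresh v
        simp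
        omega
      · intro v
        have := hT.fresh v
        simp
        omega
      · simp
    · rintro m τ hm h12 ⟨g1, ⟨st, g2, g3⟩, g4, g5, g6⟩
      refine (wp_level hp hm g1 g2 h12 (by omega)).mono ?_
      rintro ρ t ⟨f0, f1, f2, f3, f4, f5, f6⟩
      refine ⟨f0, f1, f2, ⟨_, f3, ?_⟩, f4, f5.trans g5, f6.trans g6⟩
      rw [← g3, lastLayers, List.foldl_append]
    · rintro τ t ⟨f0, f1, ⟨st, f2, f3⟩, -, f5, f6⟩
      obtain rfl : st = outcome G s par C k i := f3
      have hfresh : ∀ v : Fin n, cell τ (n + 5) v = 0 ∨ i + 1 ≤ cell τ (n + 5) v := f2.fresh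
      rw [wp_cond, f2.fail]
      split_ifs with hf
      · simp [f1, f5]
        refine ⟨by omega, hfresh, Or.inr ⟨by simp, i, hi, hf, by simp [f2.length], ?_⟩⟩
        simpa using f2.list
      · simp [f1, f5]
        refine ⟨by omega, hfresh, Or.inl ⟨by simp [f6], fun y hy hy' => ?_⟩⟩
        rcases hy.lt_or_eq with hy | rfl
        · exact hall y hy hy'
        · exact hf
  · rw [if_neg (by omega)]
    simp [h20, hP.reg3, hP]
    refine ⟨fun v => ?_, Or.inr ⟨by simpa using h21, ?_⟩⟩
    · have := hT.fresh v
      simp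
      omega
    · simpa [Found] using hfound

theorem wp_exhaust (hp : IsParentMap G s par) (hP : Prepared G s C k par σ)
    (h0 : ∀ v : Fin n, cell σ (n + 5) v = 0) :
    wp exhaust σ fun τ t =>
      t ≤ 4 ^ k * (n * (n * (n * 13 + 35 + 1) + 4 + 1) + 12 + 1) + 3 ∧
      Prepared G s C k par τ ∧ Tried G s par C k 0 τ := by
  simp only [exhaust, wp_block_cons, wp_block_singleton, wp_add, wp_const]
  refine (wp_loop (fun i τ => Prepared G s C k par τ ∧ Tried G s par C k i τ)
      (n * (n * (n * 13 + 35 + 1) + 4 + 1) + 12) (N := 4 ^ k) ?_ ?_ ?_).mono ?_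
  · simp [hP.reg10, hP.reg11]
  · exact ⟨by simp [hP], fun v => Or.inl (by simpa using h0 v),
      Or.inl ⟨by simp, fun y hy hy' => absurd hy hy'.not_ge⟩⟩
  · rintro i τ hi h20 ⟨g1, g2⟩
    exact wp_attempt hp hi g1 g2 h20
  · rintro τ t ⟨f0, f1, f2⟩
    exact ⟨by omega, f1, f2⟩

/-! ## The whole program -/

def setup : Prog := block [.const 3 1, .const 11 0, .add 12 0 3,
  .loop 12 (block [.sub 12 12 3, .add 4 4 0]),
  .add 5 4 0, .add 6 5 0, .add 7 6 0, .add 8 7 0, .add 9 8 0, .const 10 1, .add 12 2 11,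
  .loop 12 (block [.sub 12 12 3, .add 10 10 10, .add 10 10 10])]

theorem holds_input (G : SimpleGraph (Fin n)) (s : Fin n) (C : Set (Fin n)) (k : ℕ) :
    Holds G C (input G s C k) := by
  have e : ∀ u v : Fin n, n + u.val * n + v.val = n * (u.val + 1) + v.val := fun u v => by ring
  have e0 : ∀ v : Fin n, v.val = n * 0 + v.val := fun v => by simp
  constructor
  · intro v
    simp only [cell, input]
    constructor
    · intro h hv
      rw [if_pos (Or.inl ⟨v, by simp, hv⟩)] at h
      exact one_ne_zero h
    · intro hv
      rw [if_neg]
      rintro (⟨w, hw, hC⟩ | ⟨u, w, huw, -⟩)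
      · rw [e0 w, row_col_inj] at hw
        exact hv (hw.2 ▸ hC)
      · rw [e, row_col_inj] at huw
        omega
  · intro u v
    simp only [cell, input]
    constructor
    · intro h hv
      rw [if_pos (Or.inr ⟨u, v, (e u v).symm, hv⟩)] at h
      exact one_ne_zero h
    · intro hv
      rw [if_neg]
      rintro (⟨w, hw, -⟩ | ⟨u', w, huw, hadj⟩)
      · rw [e0 w, row_col_inj] at hw
        omega
      · rw [e, row_col_inj] at huw
        obtain rfl : u = u' := Fin.ext (by omega)
        exact hv (huw.2 ▸ hadj)

theorem cell_input {j : ℕ} (hj : 1 ≤ j) (v : Fin n) : cell (input G s C k) (n + j) v = 0 := by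
  have e : ∀ u v : Fin n, n + u.val * n + v.val = n * (u.val + 1) + v.val := fun u v => by ring
  have e0 : ∀ v : Fin n, v.val = n * 0 + v.val := fun v => by simp
  simp only [cell, input]
  rw [if_neg]
  rintro (⟨w, hw, -⟩ | ⟨u, w, huw, -⟩)
  · rw [e0 w, row_col_inj] at hw
    omega
  · rw [e, row_col_inj] at huw
    omega

theorem wp_setup : wp setup (input G s C k) fun τ t => t ≤ n * 3 + k * 4 + 15 ∧ Env n s k τ ∧
    Holds G C τ ∧ ∀ j, 1 ≤ j → ∀ v : Fin n, cell τ (n + j) v = 0 := by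
  have hmem : ∀ τ : State, τ.mem = (input G s C k).mem → Holds G C τ ∧
      ∀ j, 1 ≤ j → ∀ v : Fin n, cell τ (n + j) v = 0 := by
    intro τ h
    have hc : ∀ j (v : Fin n), cell τ j v = cell (input G s C k) j v := fun j v => by
      rw [cell, h]; rfl
    exact ⟨⟨fun v => hc _ v ▸ (holds_input G s C k).critical v,
      fun u v => hc _ v ▸ (holds_input G s C k).adj u v⟩, fun j hj v => hc _ v ▸ cell_input hj v⟩
  have hin : ∀ r, 3 ≤ r → (input G s C k).reg r = 0 := fun r hr => by
    simp only [input]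
    rw [if_neg (by omega), if_neg (by omega), if_neg (by omega)]
  have h0 : (input G s C k).reg 0 = n := rfl
  have h1 : (input G s C k).reg 1 = s := rfl
  have h2 : (input G s C k).reg 2 = k := rfl
  have hbase : ∀ i, i < n + 1 → n + (n - i) * n = (n + 1 - i) * n := by
    intro i hi
    rw [show n + 1 - i = n - i + 1 by omega]
    ring
  simp only [setup, wp_block_cons, wp_const, wp_add]
  refine (wp_loop (fun i τ => τ.mem = (input G s C k).mem ∧ τ.reg 0 = n ∧ τ.reg 1 = s ∧
    τ.reg 2 = k ∧ τ.reg 3 = 1 ∧ τ.reg 11 = 0 ∧ τ.reg 4 = (n + 1 - i) * n) 2 (N := n + 1)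
    ?_ ?_ ?_).mono ?_
  · simp [h0]
  · simp [h0, h1, h2, hin]
  · rintro i τ hi h12 ⟨g1, g2, g3, g4, g5, g6, g7⟩
    have := hbase i hi
    simp [h12, g1, g2, g3, g4, g5, g6, g7]
    omega
  rintro τ t ⟨f0, f1, f2, f3, f4, f5, f6, f7⟩
  simp only [wp_block_singleton]
  refine (wp_loop (fun i τ => τ.mem = (input G s C k).mem ∧ τ.reg 0 = n ∧ τ.reg 1 = s ∧
    τ.reg 2 = k ∧ τ.reg 3 = 1 ∧ τ.reg 11 = 0 ∧ τ.reg 4 = n * (n + 1) ∧ τ.reg 5 = n * (n + 2) ∧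
    τ.reg 6 = n * (n + 3) ∧ τ.reg 7 = n * (n + 4) ∧ τ.reg 8 = n * (n + 5) ∧
    τ.reg 9 = n * (n + 6) ∧ τ.reg 10 = 4 ^ (k - i)) 3 (N := k) ?_ ?_ ?_).mono ?_
  · simp [f4, f6]
  · simp [f1, f2, f3, f4, f5, f6, f7]
    refine ⟨?_, ?_, ?_, ?_, ?_, ?_⟩ <;> ring
  · rintro i ρ hi h12 ⟨g1, g2, g3, g4, g5, g6, g7, g8, g9, g10, g11, g12, g13⟩
    have e : 4 ^ (k - i) = 4 * 4 ^ (k - (i + 1)) := by rw [← pow_succ']; congr 1; omega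
    simp [h12, g1, g2, g3, g4, g5, g6, g7, g8, g9, g10, g11, g12, g13]
    omega
  · rintro ρ u ⟨e0, g1, g2, g3, g4, g5, g6, g7, g8, g9, g10, g11, g12, g13⟩
    exact ⟨by omega, ⟨g2, g3, g4, g5, g7, g8, g9, g10, g11, g12, by simpa using g13, g6⟩, hmem _ g1⟩

/-! ### Correctness of the exhaustive search -/

theorem isSound_outcome (hp : IsParentMap G s par) (y : ℕ) :
    (outcome G s par C k y).IsSound G s par C k {v | v ∈ lastLayers G s n} := by
  have := Selection.isSound_foldl (M := 4 ^ k) hp (sorted_lastLayers (G := G) (s := s) le_rfl)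
    (Selection.isSound_init (C := C) (k := k) y) (by simp)
  rwa [Set.empty_union] at this

theorem mem_layers (hp : IsParentMap G s par) {v : Fin n} (hv : v ≠ s) : v ∈ lastLayers G s n := by
  have h1 := hp.dist v hv
  have h2 := dist_lt_card hp v
  exact (mem_lastLayers le_rfl).2 (by omega)

theorem exists_outcome (hp : IsParentMap G s par) (h : SACS G s C k) :
    ∃ y < 4 ^ k, (outcome G s par C k y).fail = 0 := by
  obtain ⟨h, hsave⟩ := h
  obtain ⟨I, hI, hk, hτ⟩ := hp.exists_isTightCut hsave
  exact hI.exists_guide hp hk hτ (sorted_lastLayers le_rfl) (nodup_lastLayers le_rfl)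
    fun v => mem_layers hp

theorem outcome_saves (hp : IsParentMap G s par) (hs : s ∉ C) {y : ℕ}
    (hy : (outcome G s par C k y).fail = 0) :
    IsImportantSeparator G {s} C {v | v ∈ (outcome G s par C k y).sel} ∧
      IsIncreasingListing G s {v | v ∈ (outcome G s par C k y).sel}
        (outcome G s par C k y).sel.get ∧ Saves G s C (outcome G s par C k y).sel.get := by
  have hsound := isSound_outcome (C := C) (k := k) hp y
  have hcut := hsound.isTightCut (fun c hc => mem_layers hp (by rintro rfl; exact hs hc)) hy
  have hlist := hsound.isIncreasingListing
  refine ⟨hcut.isImportantSeparator hp, hlist, hp.saves_of_lt_dist ?_ fun j => hsound.lt_dist _ j.2⟩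
  rw [hlist.2.1]
  exact hcut.isSeparator hp

/-- With a single vertex and `k > 0` the empty selection succeeds, yet no strategy is valid because
the only vertex burns; this case is overruled first. Copying the list overwrites the vector of `C`,
which is no longer needed. -/
def output : Prog := block [.sub 12 0 3,
  .cond 12 (block []) (block [.cond 2 (block [.const 21 0]) (block [])]),
  .cond 21
    (block [.add 12 22 11, .loop 12 (block [.sub 12 12 3, .add 13 9 12, .load 13 13, .store 12 13]),
      .const 0 1, .add 1 22 11])
    (block [.const 0 0])]

theorem not_sacs_of_subsingleton {V : Type*} [Subsingleton V] {G : SimpleGraph V} {s : V} {C : Set V}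
    {k : ℕ} (hk : k ≠ 0) : ¬ SACS G s C k := by
  rintro ⟨h, hval, -⟩
  exact hval ⟨0, Nat.pos_of_ne_zero hk⟩ (Subsingleton.elim _ _)

theorem isAnswer_of_outcome (hp : IsParentMap G s par) (hs : s ∉ C) (hk : n = 1 → k = 0) {y : ℕ}
    (hy : (outcome G s par C k y).fail = 0) (h0 : σ.reg 0 = 1)
    (h1 : σ.reg 1 = (outcome G s par C k y).sel.length)
    (hmem : ∀ (i : ℕ) (h : i < (outcome G s par C k y).sel.length),
      σ.mem i = ((outcome G s par C k y).sel[i]).val) : IsAnswer G s C k σ := by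
  obtain ⟨himp, hlist, hsave⟩ := outcome_saves hp hs hy
  have hlen := (isSound_outcome (C := C) (k := k) hp y).length_le
  refine ⟨fun hno => absurd ?_ hno, fun _ => ⟨h0, h1 ▸ hlen, ?_⟩⟩
  · by_cases hn : n = 1
    · have : k = (outcome G s par C k y).sel.length := by have := hk hn; omega
      rw [this] at *
      exact ⟨_, hsave⟩
    · have : Nontrivial (Fin n) := Fin.nontrivial_iff_two_le.2 (by have := s.pos; omega)
      exact hp.sacs_of_saves hlen hsave
  · generalize σ.reg 1 = m at h1
    subst h1
    exact ⟨_, _, himp, hlist, hsave, fun i => hmem i i.2⟩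

theorem wp_output (hp : IsParentMap G s par) (hs : s ∉ C) (hP : Prepared G s C k par σ)
    (hT : Tried G s par C k 0 σ) :
    wp output σ fun τ t => t ≤ n * 5 + 13 ∧ IsAnswer G s C k τ := by
  by_cases hn : n = 1 ∧ k ≠ 0
  · have hno : ¬ SACS G s C k := by
      obtain ⟨rfl, hk⟩ := hn
      exact not_sacs_of_subsingleton hk
    simp [output, hP.reg0, hP.reg3, hP.reg2, hn.1, hn.2]
    exact ⟨fun _ => by simp, fun h => absurd h hno⟩
  have hk : n = 1 → k = 0 := fun h => by_contra fun h' => hn ⟨h, h'⟩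
  simp only [output, wp_block_cons, wp_sub, wp_block_singleton]
  have h21 : ∀ Ψ : State → ℕ → Prop, (∀ τ t, t ≤ 4 → Prepared G s C k par τ →
      τ.reg 21 = σ.reg 21 → τ.reg 22 = σ.reg 22 → τ.mem = σ.mem → Ψ τ t) →
      wp (.cond 12 (block []) (block [.cond 2 (block [.const 21 0]) (block [])]))
        (σ.setReg 12 (σ.reg 0 - σ.reg 3)) Ψ := by
    intro Ψ hΨ
    rw [wp_cond]
    split_ifs with h1
    · have hn1 : n = 1 := by
        have := s.pos
        simp [hP.reg0, hP.reg3] at h1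
        omega
      rw [wp_block_singleton, wp_cond, if_pos (by simp [hP.reg2, hk hn1])]
      rw [wp_block_nil]
      exact hΨ _ _ (by omega) (by simp [hP]) (by simp) (by simp) (by simp)
    · rw [wp_block_nil]
      exact hΨ _ _ (by omega) (by simp [hP]) (by simp) (by simp) (by simp)
  refine h21 _ fun τ t ht g1 g2 g3 g4 => ?_
  have hcell : ∀ i : Fin n, cell τ (n + 6) i = cell σ (n + 6) i := fun i => by rw [cell, g4]; rfl
  rw [wp_cond, g2]
  rcases hT.result with ⟨hr, hall⟩ | ⟨hr, y, -, hy, hlen, hcells⟩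
  · rw [if_pos hr, wp_block_singleton, wp_const]
    refine ⟨by omega, fun _ => by simp, fun h => ?_⟩
    obtain ⟨y, hy, hf⟩ := exists_outcome hp h
    exact absurd hf (hall y (Nat.zero_le _) hy)
  · rw [if_neg (by omega)]
    have hsound := isSound_outcome (C := C) (k := k) hp y
    have hle : (outcome G s par C k y).sel.length ≤ n := by
      simpa using hsound.nodup.length_le_card
    simp only [wp_block_cons, wp_block_singleton, wp_add]
    refine (wp_loop (fun i ρ => ρ.reg 3 = 1 ∧ ρ.reg 9 = n * (n + 6) ∧ ρ.reg 11 = 0 ∧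
      ρ.reg 22 = (outcome G s par C k y).sel.length ∧
      (∀ j : Fin n, cell ρ (n + 6) j = cell σ (n + 6) j) ∧
      ∀ (j : ℕ) (h : j < (outcome G s par C k y).sel.length), i ≤ j →
        ρ.mem j = ((outcome G s par C k y).sel[j]).val) 4
      (N := (outcome G s par C k y).sel.length) ?_ ?_ ?_).mono ?_
    · simp [g1.reg11, g3, hlen]
    · simp [g1.reg3, g1.reg9, g1.reg11, g3, hlen, hcell]
      exact fun j hj hj' => absurd hj' hj.not_ge
    · rintro i ρ hi h12 ⟨e1, e2, e3, e4, e5, e6⟩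
      obtain ⟨v, rfl⟩ : ∃ v : Fin n, v.val = i := ⟨⟨i, by omega⟩, rfl⟩
      have hrow : ∀ (x : ℕ) (j : Fin n), cell (ρ.setMem v.val x) (n + 6) j = cell ρ (n + 6) j := by
        intro x j
        have h1 : n * (n + 6) + j.val ≠ v.val := by
          have := Nat.le_mul_of_pos_right n (show 0 < n + 6 by omega)
          have := v.2
          omega
        rw [cell, mem_setMem, if_neg h1]
        rfl
      simp [h12, e1, e2, e3, e4, e5, hrow]
      intro j hj hij
      rw [mem_setMem]
      split_ifs with hjv
      · subst hjv
        rw [hcells v hj]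
      · exact e6 j hj (by omega)
    · rintro ρ u ⟨f0, e1, e2, e3, e4, e5, e6⟩
      simp only [wp_const]
      refine ⟨by omega, isAnswer_of_outcome hp hs hk hy (by simp) (by simp [e3, e4]) fun i hi => ?_⟩
      simpa using e6 i hi (Nat.zero_le _)

def solve : Prog :=
  block [setup, search, countBelow, markLoose, exhaust, output]

theorem wp_solve (hp : IsParentMap G s par) (hs : s ∉ C) :
    wp solve (input G s C k) fun τ t => t ≤ 4 ^ k * (1000 * (n + 1) ^ 4) ∧ IsAnswer G s C k τ := by
  simp only [solve, wp_block_cons, wp_block_singleton]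
  refine wp_setup.mono fun τ₁ t₁ ⟨ht₁, hE, hH, hz₁⟩ => ?_
  refine (wp_search hp hE hH hz₁).mono fun τ₂ t₂ ⟨ht₂, hE, hH, hR, hz₂⟩ => ?_
  refine (wp_countBelow hp ⟨hE, hH, hR⟩ hz₂).mono fun τ₃ t₃ ⟨ht₃, hR, hz₃, hc⟩ => ?_
  refine (wp_markLoose hp ⟨hR, hc⟩ hz₃).mono fun τ₄ t₄ ⟨ht₄, hC, hz₄, hl⟩ => ?_
  refine (wp_exhaust hp ⟨hC, hl⟩ (hz₄ 5 le_rfl)).mono fun τ₅ t₅ ⟨ht₅, hP, hT⟩ => ?_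
  refine (wp_output hp hs hP hT).mono fun τ₆ t₆ ⟨ht₆, hA⟩ => ⟨?_, hA⟩
  have hk : k ≤ 4 ^ k := (Nat.lt_pow_self (by norm_num)).le
  have h1 : 1 ≤ 4 ^ k := Nat.one_le_pow _ _ (by norm_num)
  generalize 4 ^ k = M at *
  -- `A` collects the costs free of `k`, `B` is the cost of one guide including its loop test, and
  -- the summand `4` below pays for the `4 * k` steps that compute `4 ^ k`, as `k ≤ 4 ^ k`.
  set A := n * 3 + 15 + (n * (n * (14 * n + 10 + 1) + 4 + 1) + 6) + (n * (n * 8 + 8 + 1) + 2) +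
    (n * (n * 12 + 12 + 1) + 2) + 3 + (n * 5 + 13) with hA
  set B := n * (n * (n * 13 + 35 + 1) + 4 + 1) + 12 + 1 with hB
  have h2 : A ≤ M * A := Nat.le_mul_of_pos_left _ h1
  have h3 : A + B + 4 ≤ 1000 * (n + 1) ^ 4 := by
    rw [hA, hB]
    ring_nf
    nlinarith [Nat.zero_le n]
  have h4 : M * (A + B + 4) ≤ M * (1000 * (n + 1) ^ 4) := Nat.mul_le_mul_left _ h3
  rw [Nat.mul_add, Nat.mul_add] at h4
  omega

end RAM

theorem mainTheorem5 :
    -- structure: exhaustive search through the important separators is complete and sound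
    (∀ (V : Type*) [Finite V] (G : SimpleGraph V), G.IsTree →
      ∀ (s : V) (C : Set V) (k : ℕ), s ∉ C →
        (SACS G s C k → ∃ I : Set V, IsImportantSeparator G {s} C I ∧ I.ncard ≤ k ∧
          (∃ e : Fin I.ncard → V, IsIncreasingListing G s I e) ∧
          ∀ e : Fin I.ncard → V, IsIncreasingListing G s I e → Saves G s C e) ∧
        (∀ I : Set V, IsImportantSeparator G {s} C I →
          ∀ (m : ℕ) (h : Fin m → V), Set.range h = I → Saves G s C h →
            ∀ e : Fin I.ncard → V, IsIncreasingListing G s I e → Saves G s C e) ∧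
        (Nontrivial V →
          ∀ I : Set V, IsImportantSeparator G {s} C I → I.ncard ≤ k →
            ∀ e : Fin I.ncard → V, IsIncreasingListing G s I e → Saves G s C e → SACS G s C k)) ∧
    -- running time: one program solves the problem on all trees in time `4 ^ k * poly(n)`
    (∃ (P : RAM.Prog) (p : Polynomial ℕ), ∀ (n : ℕ) (G : SimpleGraph (Fin n)), G.IsTree →
      ∀ (s : Fin n) (C : Set (Fin n)) (k : ℕ), s ∉ C →
        ∃ (τ : RAM.State) (t : ℕ),
          RAM.Runs P (RAM.input G s C k) τ t ∧ t ≤ 4 ^ k * p.eval n ∧ RAM.IsAnswer G s C k τ) := by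
  refine ⟨fun V _ G hG s C k _ => hG.sacs_iff_important s C k, RAM.solve,
    Polynomial.C 1000 * (Polynomial.X + 1) ^ 4, fun n G hG s C k hs => ?_⟩
  obtain ⟨par, hp⟩ := hG.exists_isParentMap s
  obtain ⟨τ, t, hrun, ht, hA⟩ := RAM.wp_solve (k := k) hp hs
  exact ⟨τ, t, hrun, by simpa using ht, hA⟩
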